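/- All graphs are finite and simple. For a Hamiltonian graph $G$, an $H$-force set of $G$ is a nonempty set $X\subseteq V(G)$ such that every cycle of $G$ containing all vertices of $X$ is a Hamiltonian cycle, and $h(G)$ denotes the smallest cardinality of an $H$-force set of $G$. A graph $G$ with $n$ vertices is an OTG if $d(u)+d(v)\ge n$ for every pair of distinct nonadjacent vertices $u,v$. The weak closure of $G$ is the graph obtained from $G$ by recursively joining pairs of distinct nonadjacent vertices whose degree sum in the current graph is at least $n+1$, until no such pair remains. We write $\vee$ for the join and $+$ for the disjoint union of graphs, $K_m$ for the complete graph on $m$ vertices, $K_m^c$ for the graph with $m$ vertices and no edges, and $K_{m,m}$ for the complete bipartite graph with parts of size $m$. **Theorem 3.1.** Let $n\ge 5$ and let $\mathcal C_w$ be the class of the weak closures of all OTGs with $n$ vertices. Define the following classes of graphs with $n$ vertices (up to isomorphism): - $\varphi_1=\{K_2\vee(K_m+K_{n-m-2}) : 1\le m<\frac n2\}$; - $\varphi_2=\{K_{n/2}^c\vee K_{n/2},\ K_{n/2,n/2}\}$ if $n$ is even, and $\varphi_2=\emptyset$ if $n$ is odd; - $\varphi_3$ consists of the complete graph $K_n$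 and, if $n$ is even, also of all graphs of the form $G=Z\vee K_m$, where $0\le m<\frac n2$ and $Z$ is a graph with $n-m$ vertices such that $d_G(x)=\frac n2$ for every $x\in V(Z)$, with the exception of the two graphs $K_2\vee(K_{n/2-1}+K_{n/2-1})$ and $K_{n/2,n/2}$. Then $\mathcal C_w$ is the disjoint union $\mathcal C_w=\varphi_1\,\dot\cup\,\varphi_2\,\dot\cup\,\varphi_3$. Moreover, for every $G_w\in\mathcal C_w$: 1. $h(G_w)=n-2$ if and only if $G_w\in\varphi_1$; 2. $h(G_w)=\frac n2$ if and only if $G_w\in\varphi_2$; 3. $h(G_w)=n$ if and only if $G_w\in\varphi_3$. -/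

import Mathlib

namespace HForce

universe u v

section General

variable {V : Type u}

/-- The join `G ∨ H` of two disjoint graphs: both graphs, together with all edges between them. -/
def join {W : Type v} (G : SimpleGraph V) (H : SimpleGraph W) : SimpleGraph (V ⊕ W) :=
  (G ⊕g H) ⊔ completeBipartiteGraph V W

/-- The complete graph on `k` vertices. -/
abbrev K (k : ℕ) : SimpleGraph (Fin k) := ⊤

/-- The edgeless graph on `k` vertices (the complement of `K k`). -/
abbrev Kc (k : ℕ) : SimpleGraph (Fin k) := ⊥

/-- The complete bipartite graph with both parts of size `k`. -/
abbrev Kbip (k : ℕ) : SimpleGraph (Fin k ⊕ Fin k) := completeBipartiteGraph (Fin k) (Fin k)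

end General

section Finite

variable {V : Type u} [Fintype V]

open Classical in
/-- The condition of Ore's theorem: `d(u) + d(v) ≥ n` for all pairs of nonadjacent vertices. -/
def IsOTG (G : SimpleGraph V) : Prop :=
  ∀ u v : V, u ≠ v → ¬ G.Adj u v → Fintype.card V ≤ G.degree u + G.degree v

open Classical in
/-- `u`, `v` are distinct nonadjacent vertices of `G` with degree sum at least `n + 1`. -/
def Joinable (G : SimpleGraph V) (u v : V) : Prop :=
  u ≠ v ∧ ¬ G.Adj u v ∧ Fintype.card V + 1 ≤ G.degree u + G.degree v

/-- `G'` arises from `G` by joining one nonadjacent pair with degree sum at least `n + 1`. -/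
def WeakStep (G G' : SimpleGraph V) : Prop :=
  ∃ u v : V, Joinable G u v ∧ G' = G ⊔ SimpleGraph.edge u v

/-- `C` is the weak closure of `G`: it is obtained from `G` by recursively joining nonadjacent
pairs with degree sum at least `n + 1` (degrees in the current graph), and no such pair remains. -/
def IsWeakClosure (G C : SimpleGraph V) : Prop :=
  Relation.ReflTransGen WeakStep G C ∧ ∀ u v : V, ¬ Joinable C u v

variable (V) in
/-- The weak closures of all graphs on `V` satisfying the condition of Ore's theorem. -/
def weakClosures : Set (SimpleGraph V) :=
  {C | ∃ G : SimpleGraph V, IsOTG G ∧ IsWeakClosure G C}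

open Classical in
/-- `X` is an `H`-force set of the Hamiltonian graph `G`: it is nonempty and every cycle of `G`
containing all vertices of `X` is a Hamiltonian cycle. -/
def IsHForceSet (G : SimpleGraph V) (X : Finset V) : Prop :=
  G.IsHamiltonian ∧ X.Nonempty ∧
    ∀ (a : V) (c : G.Walk a a), c.IsCycle → (∀ x ∈ X, x ∈ c.support) → c.IsHamiltonianCycle

/-- The `H`-force number `h(G)`: the smallest cardinality of an `H`-force set of `G`. -/
noncomputable def hForceNumber (G : SimpleGraph V) : ℕ :=
  sInf {k | ∃ X : Finset V, IsHForceSet G X ∧ X.card = k}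

variable (V) in
/-- The graphs `K_2 ∨ (K_m + K_{n-m-2})` with `1 ≤ m < n/2`, where `n = |V|`. -/
def phi1 : Set (SimpleGraph V) :=
  {G | ∃ m : ℕ, 1 ≤ m ∧ 2 * m < Fintype.card V ∧
    Nonempty (G ≃g join (K 2) (K m ⊕g K (Fintype.card V - m - 2)))}

variable (V) in
/-- The graphs `K_{n/2}^c ∨ K_{n/2}` and `K_{n/2,n/2}`, where `n = |V|` is even. -/
def phi2 : Set (SimpleGraph V) :=
  {G | ∃ k : ℕ, Fintype.card V = 2 * k ∧
    (Nonempty (G ≃g join (Kc k) (K k)) ∨ Nonempty (G ≃g Kbip k))}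

open Classical in
variable (V) in
/-- For `n = |V| = 2k` even, the graphs `Z ∨ K_m` with `0 ≤ m < n/2` and `Z` a graph on `n - m`
vertices, each of which has degree `n/2` in `Z ∨ K_m`, except for
`K_2 ∨ (K_{n/2-1} + K_{n/2-1})` and `K_{n/2,n/2}`; and, for every `n`, the complete graph. -/
def phi3 : Set (SimpleGraph V) :=
  {G | ∃ k : ℕ, Fintype.card V = 2 * k ∧
    (∃ m : ℕ, m < k ∧ ∃ Z : SimpleGraph (Fin (Fintype.card V - m)),
      (∀ z, (join Z (K m)).degree (Sum.inl z) = k) ∧ Nonempty (G ≃g join Z (K m))) ∧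
    ¬ Nonempty (G ≃g join (K 2) (K (k - 1) ⊕g K (k - 1))) ∧
    ¬ Nonempty (G ≃g Kbip k)} ∪ {⊤}

end Finite

end HForce

/-!
A weak closure of an OTG is the same as a graph in which any two nonadjacent vertices have degree
sum exactly `n` (`mem_weakClosures_iff`). If some nonadjacent pair has different degrees
`d < n - d`, then vertices of degree below `n / 2` are pairwise adjacent, likewise above `n / 2`,
and counting the non-edges between the vertices of degree `d` and those of degree `n - d` leaves
exactly two other vertices, which are universal; this gives `phi1` (`OreTight.twoCliques`).
Otherwise every non-universal vertex has degree `n / 2`, and the number of universal vertices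
separates the complete graph, `K_{n/2}^c ∨ K_{n/2}` and the graphs `Z ∨ K_m` with `m < n / 2`
(`OreTight.classification`).

The force number is computed on each class, and since the values `n - 2`, `n / 2`, `n` differ for
`n ≥ 5`, both the disjointness and the equivalences follow. Upper bounds: on `phi1` a cycle through
all non-universal vertices must use both vertices of the cut (`IsCycleSeq.not_both_sides`), on
`phi2` a cycle through an independent set of size `n / 2` alternates
(`isHForceSet_of_independent`). Lower bounds: an `H`-force set contains every vertex `v` for which
`G - v` is Hamiltonian. For `phi1` and `K_{n/2}^c ∨ K_{n/2}` this is Ore's theorem for `G - v`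
(`hamOn_of_ore`), for `K_{n/2,n/2}` one deletes a vertex from both sides. On `phi3` the graph
`G - v` has `2k - 1` vertices of degree at least `k - 1` and misses Ore's condition by one. There
`IsPathSeq.hamOn_or` applies, an analysis of the tight case of the usual crossing argument on a
Hamiltonian path: `G - v` is Hamiltonian, or contains `k` independent vertices, or consists of two
cliques sharing a vertex. The last two cases force `G` to be one of the two exceptional graphs.

Paths and cycles are handled as sequences `f : ℕ → V` restricted to the indices below their length,
and Hamiltonicity of induced subgraphs as `HamOn G s` for a vertex set `s`.
-/

namespace HForce

open Finset

/-! ### Paths and cycles as sequences, and Ore's theorem -/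

section Cyclic

variable {V : Type*} {G H : SimpleGraph V}

/-- `f 0, …, f (L - 1)` is a path of `G` with `L` vertices. -/
structure IsPathSeq (G : SimpleGraph V) (f : ℕ → V) (L : ℕ) : Prop where
  inj : ∀ i < L, ∀ j < L, f i = f j → i = j
  adj : ∀ i, i + 1 < L → G.Adj (f i) (f (i + 1))

/-- `f 0, …, f (L - 1)` are the consecutive vertices of a cycle of length `L` of `G`. -/
structure IsCycleSeq (G : SimpleGraph V) (f : ℕ → V) (L : ℕ) : Prop extends IsPathSeq G f L where
  three_le : 3 ≤ L
  closing : G.Adj (f (L - 1)) (f 0)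

/-- `G` has a cycle whose vertex set is exactly `s`, i.e. `G[s]` is Hamiltonian. -/
def HamOn (G : SimpleGraph V) (s : Finset V) : Prop :=
  ∃ f, IsCycleSeq G f #s ∧ ∀ i < #s, f i ∈ s

open Classical in
/-- The number of neighbours of `u` in `s`. -/
noncomputable def degIn (G : SimpleGraph V) (s : Finset V) (u : V) : ℕ := #{w ∈ s | G.Adj u w}

theorem exists_index {f : ℕ → V} {s : Finset V} (hinj : ∀ i < #s, ∀ j < #s, f i = f j → i = j)
    (hmem : ∀ i < #s, f i ∈ s) {v : V} (hv : v ∈ s) : ∃ i < #s, f i = v := by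
  classical
  have h : (range #s).image f = s := by
    apply eq_of_subset_of_card_le
    · intro x hx
      obtain ⟨i, hi, rfl⟩ := mem_image.1 hx
      exact hmem i (mem_range.1 hi)
    · rw [card_image_of_injOn, card_range]
      intro i hi j hj h
      exact hinj i (by simpa using hi) j (by simpa using hj) h
  rw [← h] at hv
  obtain ⟨i, hi, rfl⟩ := mem_image.1 hv
  exact ⟨i, mem_range.1 hi, rfl⟩

theorem IsPathSeq.reverse {f : ℕ → V} {L : ℕ} (hf : IsPathSeq G f L) :
    IsPathSeq G (fun i => f (L - 1 - i)) L := by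
  refine ⟨fun i hi j hj h => ?_, fun i hi => ?_⟩
  · have := hf.inj _ (by omega) _ (by omega) h
    omega
  · have := (hf.adj (L - 1 - (i + 1)) (by omega)).symm
    rwa [show L - 1 - (i + 1) + 1 = L - 1 - i by omega] at this

theorem IsCycleSeq.rotate {f : ℕ → V} {L : ℕ} (hf : IsCycleSeq G f L) {r : ℕ} (hr : r < L) :
    IsCycleSeq G (fun j => if j + r < L then f (j + r) else f (j + r - L)) L := by
  have h3 := hf.three_le
  refine ⟨⟨fun i hi j hj h => ?_, fun i hi => ?_⟩, h3, ?_⟩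
  · split_ifs at h <;> have := hf.inj _ (by omega) _ (by omega) h <;> omega
  · split_ifs
    · rw [show i + 1 + r = i + r + 1 by omega]
      exact hf.adj _ (by omega)
    · rw [show i + r = L - 1 by omega, show i + 1 + r - L = 0 by omega]
      exact hf.closing
    · omega
    · rw [show i + 1 + r - L = i + r - L + 1 by omega]
      exact hf.adj _ (by omega)
  · split_ifs
    · have : r = 0 := by omega
      subst this
      exact hf.closing
    · omega
    · rw [show L - 1 + r - L = r - 1 by omega]
      have := hf.adj (r - 1) (by omega)
      rwa [show r - 1 + 1 = 0 + r by omega] at this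
    · omega

/-- The cyclic predecessor of the index `i` among `0, …, L - 1`. -/
def cpred (L i : ℕ) : ℕ := if i = 0 then L - 1 else i - 1

theorem cpred_lt {L i : ℕ} (hi : i < L) : cpred L i < L := by
  unfold cpred; split_ifs <;> omega

theorem IsCycleSeq.adj_cpred {f : ℕ → V} {L : ℕ} (hf : IsCycleSeq G f L) {i : ℕ} (hi : i < L) :
    G.Adj (f (cpred L i)) (f i) := by
  unfold cpred
  split_ifs with h
  · subst h; exact hf.closing
  · have := hf.adj (i - 1) (by omega)
    rwa [show i - 1 + 1 = i by omega] at this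

/-- A cycle can be reindexed so as to start at any of its vertices. -/
theorem IsCycleSeq.exists_rotate {f : ℕ → V} {L : ℕ} (hf : IsCycleSeq G f L) {r : ℕ} (hr : r < L) :
    ∃ g, IsCycleSeq G g L ∧ g 0 = f r ∧ g (L - 1) = f (cpred L r) ∧
      (∀ i < L, ∃ j < L, g i = f j) ∧ ∀ i < L, ∃ j < L, g j = f i := by
  refine ⟨_, hf.rotate hr, by simp [hr], ?_, fun i hi => ?_, fun i hi => ?_⟩
  · unfold cpred
    split_ifs
    · congr 1; omega
    · omega
    · omega
    · congr 1; omega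
  · by_cases h : i + r < L
    · exact ⟨i + r, h, by simp [h]⟩
    · exact ⟨i + r - L, by omega, by simp [h]⟩
  · by_cases h : r ≤ i
    · exact ⟨i - r, by omega, by simp [h, hi]⟩
    · refine ⟨i + L - r, by omega, ?_⟩
      rw [if_neg (by omega)]
      congr 1; omega

open Classical in
theorem degIn_first {f : ℕ → V} {s : Finset V} (hf : IsPathSeq G f #s) (hmem : ∀ i < #s, f i ∈ s) :
    degIn G s (f 0) = #{i ∈ range (#s - 1) | G.Adj (f 0) (f (i + 1))} := by
  symm
  refine card_bij (fun i _ => f (i + 1)) (fun i hi => ?_) (fun i hi j hj h => ?_) fun v hv => ?_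
  · simp only [mem_filter, mem_range] at hi ⊢
    exact ⟨hmem _ (by omega), hi.2⟩
  · simp only [mem_filter, mem_range] at hi hj
    have := hf.inj _ (by omega) _ (by omega) h
    omega
  · simp only [mem_filter] at hv
    obtain ⟨i, hi, rfl⟩ := exists_index hf.inj hmem hv.1
    have h0 : i ≠ 0 := by rintro rfl; exact G.irrefl hv.2
    refine ⟨i - 1, ?_, ?_⟩
    · simp only [mem_filter, mem_range]
      rw [show i - 1 + 1 = i by omega]
      exact ⟨by omega, hv.2⟩
    · rw [show i - 1 + 1 = i by omega]

open Classical in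
theorem degIn_last {f : ℕ → V} {s : Finset V} (hf : IsPathSeq G f #s) (hmem : ∀ i < #s, f i ∈ s) :
    degIn G s (f (#s - 1)) = #{i ∈ range (#s - 1) | G.Adj (f (#s - 1)) (f i)} := by
  symm
  refine card_bij (fun i _ => f i) (fun i hi => ?_) (fun i hi j hj h => ?_) fun v hv => ?_
  · simp only [mem_filter, mem_range] at hi ⊢
    exact ⟨hmem _ (by omega), hi.2⟩
  · simp only [mem_filter, mem_range] at hi hj
    exact hf.inj _ (by omega) _ (by omega) h
  · simp only [mem_filter] at hv
    obtain ⟨i, hi, rfl⟩ := exists_index hf.inj hmem hv.1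
    have h0 : i ≠ #s - 1 := by rintro rfl; exact G.irrefl hv.2
    exact ⟨i, by simp only [mem_filter, mem_range]; exact ⟨by omega, hv.2⟩, rfl⟩

/-- A path on `s` whose first vertex is adjacent to the successor of a neighbour of the last
vertex can be closed up to a cycle on `s`, by reversing the initial segment. -/
theorem IsPathSeq.hamOn_of_crossing {f : ℕ → V} {s : Finset V} (hf : IsPathSeq G f #s)
    (hmem : ∀ i < #s, f i ∈ s) (h3 : 3 ≤ #s) {i : ℕ} (hi : i + 1 < #s)
    (h1 : G.Adj (f 0) (f (i + 1))) (h2 : G.Adj (f (#s - 1)) (f i)) : HamOn G s := by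
  refine ⟨fun j => if j ≤ i then f (i - j) else f j, ⟨⟨fun a ha b hb h => ?_, fun a ha => ?_⟩,
    h3, ?_⟩, fun a ha => ?_⟩
  · split_ifs at h <;> have := hf.inj _ (by omega) _ (by omega) h <;> omega
  · split_ifs
    · have := (hf.adj (i - (a + 1)) (by omega)).symm
      rwa [show i - (a + 1) + 1 = i - a by omega] at this
    · obtain rfl : a = i := by omega
      simpa using h1
    · omega
    · exact hf.adj _ ha
  · rw [if_neg (by omega)]
    simpa using h2
  · dsimp only
    split_ifs <;> exact hmem _ (by omega)

/-- If a path on `s` cannot be closed up, no index `i` is both a predecessor of a neighbour of the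
first vertex and a neighbour of the last one. If the degrees of both ends add up to at least
`#s - 1`, then this forces every index to be exactly one of the two. -/
theorem IsPathSeq.degIn_add_lt {f : ℕ → V} {s : Finset V} (hf : IsPathSeq G f #s)
    (hmem : ∀ i < #s, f i ∈ s) (h3 : 3 ≤ #s) (hs : ¬ HamOn G s) :
    degIn G s (f 0) + degIn G s (f (#s - 1)) < #s ∧
    (#s ≤ degIn G s (f 0) + degIn G s (f (#s - 1)) + 1 →
      ∀ i, i + 1 < #s → (G.Adj (f 0) (f (i + 1)) ↔ ¬ G.Adj (f (#s - 1)) (f i))) := by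
  classical
  have hx : ∀ i, i + 1 < #s → G.Adj (f 0) (f (i + 1)) → ¬ G.Adj (f (#s - 1)) (f i) :=
    fun i hi h1 h2 => hs (hf.hamOn_of_crossing hmem h3 hi h1 h2)
  rw [degIn_first hf hmem, degIn_last hf hmem]
  have hd : Disjoint {i ∈ range (#s - 1) | G.Adj (f 0) (f (i + 1))}
      {i ∈ range (#s - 1) | G.Adj (f (#s - 1)) (f i)} := by
    rw [disjoint_filter]
    intro i hi
    exact hx i (by simp at hi; omega)
  rw [← card_union_of_disjoint hd]
  have hsub : {i ∈ range (#s - 1) | G.Adj (f 0) (f (i + 1))} ∪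
      {i ∈ range (#s - 1) | G.Adj (f (#s - 1)) (f i)} ⊆ range (#s - 1) :=
    union_subset (filter_subset _ _) (filter_subset _ _)
  have hc := card_le_card hsub
  rw [card_range] at hc
  refine ⟨by omega, fun h i hi => ⟨hx i hi, fun h2 => ?_⟩⟩
  have he := eq_of_subset_of_card_le hsub (by rw [card_range]; omega)
  have : i ∈ range (#s - 1) := by simp; omega
  rw [← he] at this
  rcases mem_union.1 this with h' | h'
  · exact (mem_filter.1 h').2
  · exact absurd (mem_filter.1 h').2 h2

theorem degIn_mono (h : G ≤ H) (s : Finset V) (u : V) : degIn G s u ≤ degIn H s u := by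
  classical
  exact card_le_card fun x hx => by
    simp only [mem_filter] at hx ⊢
    exact ⟨hx.1, h hx.2⟩

theorem hamOn_of_clique {s : Finset V} (h3 : 3 ≤ #s) (h : ∀ u ∈ s, ∀ w ∈ s, u ≠ w → G.Adj u w) :
    HamOn G s := by
  have : Nonempty V := by
    obtain ⟨x, -⟩ := card_pos.1 (by omega : 0 < #s)
    exact ⟨x⟩
  have e := s.equivFin.symm
  let f : ℕ → V := fun i => if hi : i < #s then e ⟨i, hi⟩ else Classical.arbitrary V
  have hf : ∀ i (hi : i < #s), f i = e ⟨i, hi⟩ := fun i hi => by simp [f, hi]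
  have hmem : ∀ i < #s, f i ∈ s := fun i hi => by rw [hf i hi]; exact (e _).2
  have hinj : ∀ i < #s, ∀ j < #s, f i = f j → i = j := fun i hi j hj hij => by
    rw [hf i hi, hf j hj] at hij
    simpa using e.injective (Subtype.ext hij)
  exact ⟨f, ⟨⟨hinj, fun i hi => h _ (hmem _ (by omega)) _ (hmem _ hi) fun e => by
    have := hinj _ (by omega) _ hi e; omega⟩, h3,
    h _ (hmem _ (by omega)) _ (hmem _ (by omega)) fun e => by
    have := hinj _ (by omega) _ (by omega) e; omega⟩, hmem⟩

/-- **Ore's theorem** for the subgraph induced on `s`. In a maximal non-Hamiltonian graph, two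
nonadjacent vertices are the ends of a path on `s`, to which the degree bound applies. -/
theorem hamOn_of_ore [Finite V] {s : Finset V} (h3 : 3 ≤ #s)
    (h : ∀ u ∈ s, ∀ w ∈ s, u ≠ w → ¬ G.Adj u w → #s ≤ degIn G s u + degIn G s w) :
    HamOn G s := by
  by_contra hG
  obtain ⟨M, hGM, hM, hmax⟩ := Finite.exists_le_maximal (p := fun M => ¬ HamOn M s) hG
  obtain ⟨u, hu, w, hw, huw, hn⟩ : ∃ u ∈ s, ∃ w ∈ s, u ≠ w ∧ ¬ M.Adj u w := by
    by_contra! hc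
    exact hM (hamOn_of_clique h3 fun u hu w hw huw => by
      by_contra h'; exact h' (hc u hu w hw huw))
  have hlt := SimpleGraph.lt_sup_edge M u w huw hn
  obtain ⟨f, hf, hmem⟩ : HamOn (M ⊔ SimpleGraph.edge u w) s := by
    by_contra hc
    exact hlt.not_ge (hmax hc hlt.le)
  -- the cycle uses the additional edge, so it may be assumed to close up with it
  obtain ⟨r, hr, hrM⟩ : ∃ r < #s, ¬ M.Adj (f (cpred #s r)) (f r) := by
    by_contra! hc
    refine hM ⟨f, ⟨⟨hf.inj, fun i hi => ?_⟩, h3, hc 0 (by omega)⟩, hmem⟩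
    simpa [cpred] using hc (i + 1) hi
  obtain ⟨g, hg, hg0, hg1, hgm, -⟩ := hf.exists_rotate hr
  have hgmem : ∀ i < #s, g i ∈ s := fun i hi => by
    obtain ⟨j, hj, e⟩ := hgm i hi
    rw [e]; exact hmem j hj
  rw [← hg0, ← hg1] at hrM
  have hedge : ∀ a b, (M ⊔ SimpleGraph.edge u w).Adj a b →
      M.Adj a b ∨ (a = u ∧ b = w ∨ a = w ∧ b = u) := by
    intro a b hab
    rw [SimpleGraph.sup_adj, SimpleGraph.edge_adj] at hab
    tauto
  have hpath : IsPathSeq M g #s := by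
    refine ⟨hg.inj, fun i hi => ?_⟩
    refine (hedge _ _ (hg.adj i hi)).resolve_right fun h1 => ?_
    have h2 := (hedge _ _ hg.closing).resolve_left hrM
    have key : (g i = g (#s - 1) ∧ g (i + 1) = g 0) ∨ (g i = g 0 ∧ g (i + 1) = g (#s - 1)) := by
      rcases h1 with ⟨a, b⟩ | ⟨a, b⟩ <;> rcases h2 with ⟨c, d⟩ | ⟨c, d⟩ <;> simp [a, b, c, d]
    rcases key with ⟨_, b⟩ | ⟨a, b⟩
    · have := hg.inj _ (by omega) _ (by omega) b
      omega
    · have := hg.inj _ (by omega) _ (by omega) a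
      have := hg.inj _ (by omega) _ (by omega) b
      omega
  have h1 := (hpath.degIn_add_lt hgmem h3 hM).1
  have h2 := h (g 0) (hgmem _ (by omega)) (g (#s - 1)) (hgmem _ (by omega))
    (fun e => by have := hg.inj _ (by omega) _ (by omega) e; omega)
    fun e => hrM (hGM e).symm
  have h4 := degIn_mono hGM s (g 0)
  have h5 := degIn_mono hGM s (g (#s - 1))
  omega

end Cyclic

/-! ### One below Ore's bound -/

section NearOre

variable {V : Type*} {G H : SimpleGraph V}

theorem cpred_inj {L i j : ℕ} (hi : i < L) (hj : j < L) (h : cpred L i = cpred L j) : i = j := by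
  unfold cpred at h; split_ifs at h <;> omega

open Classical in
/-- A set of pairwise non-consecutive indices on a cycle of length `L` has at most `L / 2` elements;
if it has that many, then it alternates. -/
theorem two_mul_card_le_of_no_consecutive {L : ℕ} {p : ℕ → Prop}
    (h : ∀ i < L, p i → ¬ p (cpred L i)) :
    2 * #{i ∈ range L | p i} ≤ L ∧
      (L ≤ 2 * #{i ∈ range L | p i} → ∀ i < L, (p i ↔ ¬ p (cpred L i))) := by
  have hc : #{i ∈ range L | p (cpred L i)} = #{i ∈ range L | p i} := by
    refine card_bij (fun i _ => cpred L i) (fun i hi => ?_) (fun i hi j hj e => ?_) fun b hb => ?_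
    · simp only [mem_filter, mem_range] at hi ⊢
      exact ⟨cpred_lt hi.1, hi.2⟩
    · simp only [mem_filter, mem_range] at hi hj
      exact cpred_inj hi.1 hj.1 e
    · simp only [mem_filter, mem_range] at hb ⊢
      have : cpred L (if b + 1 = L then 0 else b + 1) = b := by
        by_cases h : b + 1 = L <;> simp [cpred, h]; omega
      refine ⟨if b + 1 = L then 0 else b + 1, ⟨by have := hb.1; split_ifs <;> omega, ?_⟩, this⟩
      rw [this]; exact hb.2
  have hd : Disjoint {i ∈ range L | p i} {i ∈ range L | p (cpred L i)} :=
    disjoint_filter.2 fun i hi => h i (mem_range.1 hi)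
  have hsub : {i ∈ range L | p i} ∪ {i ∈ range L | p (cpred L i)} ⊆ range L :=
    union_subset (filter_subset _ _) (filter_subset _ _)
  have hle := card_le_card hsub
  have hu := card_union_of_disjoint hd
  rw [card_range] at hle
  refine ⟨by omega, fun h2 i hi => ⟨h i hi, fun hn => ?_⟩⟩
  have he := eq_of_subset_of_card_le hsub (by rw [card_range]; omega)
  have hm := mem_range.2 hi
  rw [← he] at hm
  rcases mem_union.1 hm with h' | h'
  · exact (mem_filter.1 h').2
  · exact absurd (mem_filter.1 h').2 hn

/-- A vertex adjacent to two consecutive vertices of a cycle can be inserted between them. -/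
theorem IsCycleSeq.insert {g : ℕ → V} {L : ℕ} (hg : IsCycleSeq G g L) {y : V}
    (hy : ∀ i < L, g i ≠ y) {j : ℕ} (hj : j < L) (h1 : G.Adj y (g j))
    (h2 : G.Adj y (g (cpred L j))) :
    IsCycleSeq G (fun t => if t < j then g t else if t = j then y else g (t - 1)) (L + 1) := by
  have h3 := hg.three_le
  refine ⟨⟨fun a ha b hb h => ?_, fun a ha => ?_⟩, by omega, ?_⟩
  · split_ifs at h <;> first
      | omega
      | exact absurd h (hy _ (by omega))
      | exact absurd h.symm (hy _ (by omega))
      | (have := hg.inj _ (by omega) _ (by omega) h; omega)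
  · split_ifs
    · exact hg.adj a (by omega)
    · have : cpred L j = a := by unfold cpred; split_ifs <;> omega
      rw [this] at h2
      exact h2.symm
    all_goals first
      | omega
      | (rename a = j => e; subst e; exact h1)
      | (have := hg.adj (a - 1) (by omega); rwa [show a - 1 + 1 = a + 1 - 1 by omega] at this)
  · rw [if_neg (by omega), if_neg (by omega)]
    split_ifs
    · exact hg.closing
    · have : cpred L j = L - 1 := by unfold cpred; split_ifs <;> omega
      rw [this] at h2
      exact h2.symm
    · omega

section Alternating

variable {g : ℕ → V} {L : ℕ} {s : Finset V} {y : V}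

open Classical in
theorem degIn_eq_card_cycle (hg : IsCycleSeq G g L) (hmem : ∀ i < L, g i ∈ s) (hys : y ∈ s)
    (hs : #s = L + 1) (hy : ∀ i < L, g i ≠ y) :
    (∀ v ∈ s, v ≠ y → ∃ i < L, g i = v) ∧ degIn G s y = #{i ∈ range L | G.Adj y (g i)} := by
  have hcard : #(s.erase y) = L := by rw [card_erase_of_mem hys]; omega
  have hsurj : ∀ v ∈ s, v ≠ y → ∃ i < L, g i = v := by
    intro v hv hvy
    have := exists_index (f := g) (s := s.erase y) (by rw [hcard]; exact hg.inj)
      (by rw [hcard]; exact fun i hi => mem_erase.2 ⟨hy i hi, hmem i hi⟩) (mem_erase.2 ⟨hvy, hv⟩)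
    rwa [hcard] at this
  refine ⟨hsurj, ?_⟩
  symm
  refine card_bij (fun i _ => g i) (fun i hi => ?_) (fun i hi j hj e => ?_) fun v hv => ?_
  · simp only [mem_filter, mem_range] at hi ⊢
    exact ⟨hmem _ hi.1, hi.2⟩
  · simp only [mem_filter, mem_range] at hi hj
    exact hg.inj _ hi.1 _ hj.1 e
  · simp only [mem_filter] at hv
    obtain ⟨i, hi, rfl⟩ := hsurj v hv.1 (by rintro rfl; exact G.irrefl hv.2)
    exact ⟨i, by simp [hi, hv.2], rfl⟩

/-- If a cycle misses exactly the vertex `y` of `s`, which has at least `L / 2` neighbours, and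
`s` carries no cycle, then `y` is adjacent to exactly every other vertex of the cycle. -/
theorem IsCycleSeq.alternating (hg : IsCycleSeq G g L) (hmem : ∀ i < L, g i ∈ s) (hys : y ∈ s)
    (hs : #s = L + 1) (hy : ∀ i < L, g i ≠ y) (hn : ¬ HamOn G s) (hdeg : L ≤ 2 * degIn G s y) :
    2 * degIn G s y ≤ L ∧ (∀ i < L, (G.Adj y (g i) ↔ ¬ G.Adj y (g (cpred L i)))) ∧
      ∀ i < L, (G.Adj y (g i) ↔ (Even i ↔ G.Adj y (g 0))) := by
  classical
  have hno : ∀ i < L, G.Adj y (g i) → ¬ G.Adj y (g (cpred L i)) := by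
    intro i hi h1 h2
    refine hn ⟨_, hs ▸ hg.insert hy hi h1 h2, fun t ht => ?_⟩
    split_ifs
    · exact hmem _ (by omega)
    · exact hys
    · exact hmem _ (by omega)
  obtain ⟨hc, halt⟩ := two_mul_card_le_of_no_consecutive hno
  have hd := (degIn_eq_card_cycle hg hmem hys hs hy).2
  rw [hd] at hdeg ⊢
  have halt := halt hdeg
  refine ⟨hc, halt, fun i => ?_⟩
  induction i with
  | zero => simp
  | succ i ih =>
    intro hi
    have h1 := ih (by omega)
    have h2 := halt (i + 1) hi
    rw [show cpred L (i + 1) = i by simp [cpred]] at h2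
    rw [h2, h1, Nat.even_add_one]
    tauto

/-- If a cycle misses a single vertex `y` of `s`, all degrees in `s` are at least `L / 2`, and `s`
carries no cycle, then the non-neighbours of `y` in `s` are independent: each of them can be
exchanged for `y` on the cycle, so that it sees the same alternating pattern. -/
theorem IsCycleSeq.independent (hg : IsCycleSeq G g L) (hmem : ∀ i < L, g i ∈ s) (hys : y ∈ s)
    (hs : #s = L + 1) (hy : ∀ i < L, g i ≠ y) (hn : ¬ HamOn G s)
    (hdeg : ∀ u ∈ s, L ≤ 2 * degIn G s u) :
    ∃ W ⊆ s, 2 * #W = L + 2 ∧ ∀ u ∈ W, ∀ w ∈ W, ¬ G.Adj u w := by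
  classical
  obtain ⟨hc, halt, hpar⟩ := hg.alternating hmem hys hs hy hn (hdeg y hys)
  have hsurj := (degIn_eq_card_cycle hg hmem hys hs hy).1
  refine ⟨{w ∈ s | ¬ G.Adj y w}, filter_subset _ _, ?_, fun u hu w hw huw => ?_⟩
  · have h1 := card_filter_add_card_filter_not (s := s) (fun w => G.Adj y w)
    have h2 := hdeg y hys
    have h4 : degIn G s y = #{w ∈ s | G.Adj y w} := by unfold degIn; congr
    omega
  simp only [mem_filter] at hu hw
  rcases eq_or_ne u y with rfl | huy
  · exact hw.2 huw
  rcases eq_or_ne w y with rfl | hwy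
  · exact hu.2 huw.symm
  obtain ⟨i, hi, rfl⟩ := hsurj u hu.1 huy
  obtain ⟨j, hj, rfl⟩ := hsurj w hw.1 hwy
  have hij : j ≠ i := by rintro rfl; exact G.irrefl huw
  have hup : ∀ t, t ≠ i → Function.update g i y t = g t := fun t ht =>
    Function.update_of_ne ht _ _
  have hui : Function.update g i y i = y := Function.update_self _ _ _
  have hstep : ∀ t < L, G.Adj (Function.update g i y (cpred L t)) (Function.update g i y t) := by
    intro t ht
    have h3 := hg.three_le
    by_cases hti : t = i
    · subst hti
      have : cpred L t ≠ t := by unfold cpred; split_ifs <;> omega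
      rw [hui, hup _ this]
      have := halt t hi
      exact (not_not.1 (fun h => hu.2 (this.2 h))).symm
    · rw [hup t hti]
      by_cases hpi : cpred L t = i
      · rw [hpi, hui]
        refine (halt t ht).2 ?_
        rw [hpi]; exact hu.2
      · rw [hup _ hpi]
        exact hg.adj_cpred ht
  have hg' : IsCycleSeq G (Function.update g i y) L := by
    refine ⟨⟨fun a ha b hb e => ?_, fun a ha => ?_⟩, hg.three_le, ?_⟩
    · by_cases hai : a = i <;> by_cases hbi : b = i
      · omega
      · rw [hai, hui, hup b hbi] at e
        exact absurd e.symm (hy b hb)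
      · rw [hbi, hui, hup a hai] at e
        exact absurd e (hy a ha)
      · rw [hup a hai, hup b hbi] at e
        exact hg.inj a ha b hb e
    · simpa [cpred] using hstep (a + 1) ha
    · have := hstep 0 (by omega)
      rwa [show cpred L 0 = L - 1 by simp [cpred]] at this
  obtain ⟨-, -, hpar'⟩ := hg'.alternating (y := g i) (s := s) (fun t ht => by
      by_cases hti : t = i
      · rw [hti, hui]; exact hys
      · rw [hup t hti]; exact hmem t ht) hu.1 hs (fun t ht => by
      by_cases hti : t = i
      · rw [hti, hui]; exact huy.symm
      · rw [hup t hti]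
        exact fun e => hti (hg.inj t ht i hi e)) hn (hdeg _ hu.1)
  have e1 := hpar i hi
  have e2 := hpar j hj
  have e3 := hpar' i hi
  have e4 := hpar' j hj
  rw [hui] at e3
  rw [hup j hij] at e4
  have e5 : ¬ G.Adj (g i) y := fun h => hu.2 h.symm
  tauto

end Alternating

section TwoCliques

variable {f : ℕ → V} {k : ℕ} {s : Finset V}

/-- If the neighbours of the last vertex of a path on `2k - 1` vertices are exactly the `k - 1`
vertices before it, then the first `k` vertices form a clique that no other edges leave except at
its last vertex: the first vertex can be exchanged for any other by reversing an initial segment. -/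
theorem IsPathSeq.adj_iff_of_threshold (hf : IsPathSeq G f #s) (hmem : ∀ i < #s, f i ∈ s)
    (hk : 3 ≤ k) (hs : #s + 1 = 2 * k) (hn : ¬ HamOn G s) (hdeg : ∀ u ∈ s, k ≤ degIn G s u + 1)
    (hth : ∀ i, i + 1 < #s → (G.Adj (f (#s - 1)) (f i) ↔ k ≤ i + 1)) :
    ∀ i, i + 1 < k → ∀ j < #s, j ≠ i → (G.Adj (f i) (f j) ↔ j < k) := by
  intro i hi j hj hji
  have h0i : G.Adj (f 0) (f (i + 1)) := by
    have := (hf.degIn_add_lt hmem (by omega) hn).2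
      (by have := hdeg _ (hmem 0 (by omega)); have := hdeg _ (hmem (#s - 1) (by omega)); omega)
      i (by omega)
    rw [this, hth i (by omega)]
    omega
  have hg : IsPathSeq G (fun j => if j ≤ i then f (i - j) else f j) #s := by
    refine ⟨fun a ha b hb h => ?_, fun a ha => ?_⟩
    · split_ifs at h <;> have := hf.inj _ (by omega) _ (by omega) h <;> omega
    · split_ifs
      · have := (hf.adj (i - (a + 1)) (by omega)).symm
        rwa [show i - (a + 1) + 1 = i - a by omega] at this
      · obtain rfl : a = i := by omega
        simpa using h0i
      · omega
      · exact hf.adj _ ha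
  have hgm : ∀ t < #s, (fun j => if j ≤ i then f (i - j) else f j) t ∈ s := by
    intro t ht
    dsimp only
    split_ifs <;> exact hmem _ (by omega)
  have key := (hg.degIn_add_lt hgm (by omega) hn).2
    (by
      have h1 := hdeg _ (hgm 0 (by omega))
      have h2 := hdeg _ (hgm (#s - 1) (by omega))
      refine le_trans (by omega) (Nat.add_le_add_right (Nat.add_le_add (Nat.sub_le_of_le_add h1)
        (Nat.sub_le_of_le_add h2)) 1))
  simp only [Nat.zero_le, if_true, Nat.sub_zero, if_neg (show ¬ #s - 1 ≤ i by omega)] at key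
  rcases lt_or_gt_of_ne hji with h | h
  · have := key (i - j - 1) (by omega)
    rw [if_pos (by omega), if_pos (by omega), show i - (i - j - 1 + 1) = j by omega,
      show i - (i - j - 1) = j + 1 by omega, hth _ (by omega)] at this
    rw [this]; omega
  · have := key (j - 1) (by omega)
    rw [show j - 1 + 1 = j by omega, if_neg (by omega)] at this
    rw [this]
    split_ifs
    · rw [hth _ (by omega)]; omega
    · rw [hth _ (by omega)]; omega

/-- A path on `2k - 1` vertices of degree at least `k - 1` each either closes up to a cycle on the
same vertices, or its vertices contain an independent set of size `k`, or they consist of two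
cliques of size `k` that share a single vertex. -/
theorem IsPathSeq.hamOn_or (hf : IsPathSeq G f #s) (hmem : ∀ i < #s, f i ∈ s)
    (hk : 3 ≤ k) (hs : #s + 1 = 2 * k) (hdeg : ∀ u ∈ s, k ≤ degIn G s u + 1) :
    HamOn G s ∨ (∃ W ⊆ s, #W = k ∧ ∀ u ∈ W, ∀ w ∈ W, ¬ G.Adj u w) ∨
    ∃ A ⊆ s, ∃ B ⊆ s, #A + 1 = k ∧ #B + 1 = k ∧ Disjoint A B ∧
      ∀ u ∈ s, ∀ w ∈ s, u ≠ w → (G.Adj u w ↔ ¬ ((u ∈ A ∧ w ∈ B) ∨ (u ∈ B ∧ w ∈ A))) := by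
  classical
  refine or_iff_not_imp_left.2 fun hn => ?_
  have hd0 := hdeg _ (hmem 0 (by omega))
  have hd1 := hdeg _ (hmem (#s - 1) (by omega))
  obtain ⟨hlt, hT⟩ := hf.degIn_add_lt hmem (by omega) hn
  replace hT := hT (by omega)
  by_cases hA : ∃ i, i + 2 < #s ∧ G.Adj (f (#s - 1)) (f i) ∧ G.Adj (f 0) (f (i + 2))
  · left
    obtain ⟨i, hi, h1, h2⟩ := hA
    -- two crossing chords around `f (i + 1)` give a cycle that misses just this vertex
    have hcyc : IsCycleSeq G (fun j => if j ≤ i then f j else f (#s - (j - i))) (#s - 1) := by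
      refine ⟨⟨fun a ha b hb h => ?_, fun a ha => ?_⟩, by omega, ?_⟩
      · split_ifs at h <;> have := hf.inj _ (by omega) _ (by omega) h <;> omega
      · split_ifs
        · exact hf.adj _ (by omega)
        · obtain rfl : a = i := by omega
          rw [show #s - (a + 1 - a) = #s - 1 by omega]
          exact h1.symm
        · omega
        · have := (hf.adj (#s - (a + 1 - i)) (by omega)).symm
          rwa [show #s - (a + 1 - i) + 1 = #s - (a - i) by omega] at this
      · rw [if_neg (by omega), if_pos (by omega), show #s - (#s - 1 - 1 - i) = i + 2 by omega]
        exact h2.symm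
    obtain ⟨W, hW, hWc, hWi⟩ := hcyc.independent (s := s) (y := f (i + 1))
      (fun t ht => by split_ifs <;> exact hmem _ (by omega)) (hmem _ (by omega))
      (by omega) (fun t ht e => by
        split_ifs at e <;> have := hf.inj _ (by omega) _ (by omega) e <;> omega) hn
      (fun u hu => by have := hdeg u hu; omega)
    exact ⟨W, hW, by omega, hWi⟩
  · right
    push Not at hA
    -- the neighbours of the last vertex are then closed under taking successors, so they are the
    -- last `k - 1` vertices before it
    have hup : ∀ i, i + 2 < #s → G.Adj (f (#s - 1)) (f i) → G.Adj (f (#s - 1)) (f (i + 1)) := by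
      intro i hi h
      by_contra h'
      exact hA i hi h ((hT (i + 1) hi).2 h')
    have hup' : ∀ i j, i ≤ j → j + 1 < #s → G.Adj (f (#s - 1)) (f i) →
        G.Adj (f (#s - 1)) (f j) := by
      intro i j hij
      induction j, hij using Nat.le_induction with
      | base => exact fun _ h => h
      | succ j hj ih => exact fun h1 h2 => hup j h1 (ih (by omega) h2)
    have hlast := degIn_last hf hmem
    have hth1 : ∀ i, i + 1 < #s → G.Adj (f (#s - 1)) (f i) → k ≤ i + 1 := by
      intro i hi h
      have hsub : Ico i (#s - 1) ⊆ {i ∈ range (#s - 1) | G.Adj (f (#s - 1)) (f i)} := by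
        intro j hj
        simp only [mem_Ico, mem_filter, mem_range] at hj ⊢
        exact ⟨hj.2, hup' i j hj.1 (by omega) h⟩
      have := card_le_card hsub
      rw [Nat.card_Ico] at this
      omega
    have hth : ∀ i, i + 1 < #s → (G.Adj (f (#s - 1)) (f i) ↔ k ≤ i + 1) := by
      refine fun i hi => ⟨hth1 i hi, fun h => ?_⟩
      have hsub : {i ∈ range (#s - 1) | G.Adj (f (#s - 1)) (f i)} ⊆ Ico (k - 1) (#s - 1) := by
        intro j hj
        simp only [mem_Ico, mem_filter, mem_range] at hj ⊢
        have := hth1 j (by omega) hj.2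
        omega
      have he := eq_of_subset_of_card_le hsub (by rw [Nat.card_Ico]; omega)
      have : i ∈ Ico (k - 1) (#s - 1) := by simp; omega
      rw [← he] at this
      exact (mem_filter.1 this).2
    have hleft := hf.adj_iff_of_threshold hmem hk hs hn hdeg hth
    have hright : ∀ i, k ≤ i → i < #s → ∀ j < #s, j ≠ i → (G.Adj (f i) (f j) ↔ k ≤ j + 1) := by
      intro i hi his j hj hji
      have := hf.reverse.adj_iff_of_threshold (fun t ht => hmem _ (by omega)) hk hs hn hdeg
        (fun t ht => by
          rw [show #s - 1 - (#s - 1) = 0 by omega, hleft 0 (by omega) _ (by omega) (by omega)]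
          omega) (#s - 1 - i) (by omega) (#s - 1 - j) (by omega) (by omega)
      rw [show #s - 1 - (#s - 1 - i) = i by omega, show #s - 1 - (#s - 1 - j) = j by omega] at this
      rw [this]; omega
    have hA : ∀ i < #s, (f i ∈ (range (k - 1)).image f ↔ i + 1 < k) := by
      intro i hi
      simp only [mem_image, mem_range]
      constructor
      · rintro ⟨t, ht, e⟩
        have := hf.inj _ (by omega) _ hi e
        omega
      · exact fun h => ⟨i, by omega, rfl⟩
    have hB : ∀ i < #s, (f i ∈ (Ico k #s).image f ↔ k ≤ i) := by
      intro i hi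
      simp only [mem_image, mem_Ico]
      constructor
      · rintro ⟨t, ht, e⟩
        have := hf.inj _ (by omega) _ hi e
        omega
      · exact fun h => ⟨i, by omega, rfl⟩
    refine ⟨(range (k - 1)).image f, ?_, (Ico k #s).image f, ?_, ?_, ?_, ?_, ?_⟩
    · intro x hx
      obtain ⟨i, hi, rfl⟩ := mem_image.1 hx
      exact hmem i (by simp at hi; omega)
    · intro x hx
      obtain ⟨i, hi, rfl⟩ := mem_image.1 hx
      exact hmem i (by simp at hi; omega)
    · rw [card_image_of_injOn, card_range]
      · omega
      · intro i hi j hj e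
        simp only [coe_range, Set.mem_Iio] at hi hj
        exact hf.inj i (by omega) j (by omega) e
    · rw [card_image_of_injOn, Nat.card_Ico]
      · omega
      · intro i hi j hj e
        simp only [coe_Ico, Set.mem_Ico] at hi hj
        exact hf.inj i (by omega) j (by omega) e
    · rw [disjoint_left]
      intro x hx hx'
      obtain ⟨i, hi, rfl⟩ := mem_image.1 hx
      simp only [mem_range] at hi
      have := (hB i (by omega)).1 hx'
      omega
    · intro u hu w hw huw
      obtain ⟨i, hi, rfl⟩ := exists_index hf.inj hmem hu
      obtain ⟨j, hj, rfl⟩ := exists_index hf.inj hmem hw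
      have hij : j ≠ i := by rintro rfl; exact huw rfl
      rw [hA i hi, hA j hj, hB i hi, hB j hj]
      by_cases h1 : i + 1 < k
      · rw [hleft i h1 j hj hij]; omega
      by_cases h2 : k ≤ i
      · rw [hright i h2 hi j hj hij]; omega
      by_cases h3 : j + 1 < k
      · rw [G.adj_comm, hleft j h3 i hi hij.symm]; omega
      · rw [G.adj_comm, hright j (by omega) hj i hi hij.symm]; omega

end TwoCliques

end NearOre

/-! ### Cycles as walks, and H-force sets -/

section Force

variable {V : Type*} {G : SimpleGraph V}

theorem IsPathSeq.exists_isPath {f : ℕ → V} {L : ℕ} (hf : IsPathSeq G f L) :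
    ∀ k < L, ∃ p : G.Walk (f 0) (f k), p.IsPath ∧ p.length = k ∧
      ∀ v, v ∈ p.support ↔ ∃ i ≤ k, f i = v := by
  intro k
  induction k with
  | zero =>
    intro _
    exact ⟨.nil, by simp, rfl, fun v => by simp [eq_comm]⟩
  | succ k ih =>
    intro hk
    obtain ⟨p, hp, hl, hs⟩ := ih (by omega)
    refine ⟨p.concat (hf.adj k hk), ?_, by simp [hl], fun v => ?_⟩
    · refine hp.concat (fun hm => ?_) _
      obtain ⟨i, hi, e⟩ := (hs _).1 hm
      have := hf.inj _ (by omega) _ hk e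
      omega
    · rw [SimpleGraph.Walk.support_concat, List.mem_append, List.mem_singleton, hs]
      constructor
      · rintro (⟨i, hi, rfl⟩ | rfl)
        · exact ⟨i, by omega, rfl⟩
        · exact ⟨k + 1, le_rfl, rfl⟩
      · rintro ⟨i, hi, rfl⟩
        rcases Nat.le_or_eq_of_le_succ hi with h | rfl
        · exact Or.inl ⟨i, h, rfl⟩
        · exact Or.inr rfl

theorem IsCycleSeq.exists_walk {f : ℕ → V} {L : ℕ} (hf : IsCycleSeq G f L) :
    ∃ (a : V) (c : G.Walk a a), c.IsCycle ∧ c.length = L ∧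
      ∀ v, v ∈ c.support ↔ ∃ i < L, f i = v := by
  have h3 := hf.three_le
  obtain ⟨p, hp, hl, hs⟩ := hf.exists_isPath (L - 1) (by omega)
  refine ⟨_, .cons hf.closing p, ?_, by simp [hl]; omega, fun v => ?_⟩
  · rw [SimpleGraph.Walk.isCycle_iff_isPath_tail_and_le_length]
    exact ⟨by simpa using hp, by simp [hl]; omega⟩
  · rw [SimpleGraph.Walk.support_cons, List.mem_cons, hs]
    constructor
    · rintro (rfl | ⟨i, hi, rfl⟩)
      · exact ⟨L - 1, by omega, rfl⟩
      · exact ⟨i, by omega, rfl⟩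
    · rintro ⟨i, hi, rfl⟩
      exact Or.inr ⟨i, by omega, rfl⟩

theorem isCycleSeq_getVert {a : V} {c : G.Walk a a} (hc : c.IsCycle) :
    IsCycleSeq G c.getVert c.length ∧ ∀ v, v ∈ c.support ↔ ∃ i < c.length, c.getVert i = v := by
  have h3 := hc.three_le_length
  refine ⟨⟨⟨fun i hi j hj e => ?_, fun i hi => c.adj_getVert_succ (by omega)⟩, h3, ?_⟩,
    fun v => ?_⟩
  · exact hc.getVert_injOn' (by simp only [Set.mem_ofPred_eq]; omega)
      (by simp only [Set.mem_ofPred_eq]; omega) e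
  · have := c.adj_getVert_succ (i := c.length - 1) (by omega)
    rw [show c.length - 1 + 1 = c.length by omega, c.getVert_length] at this
    simpa using this
  · rw [SimpleGraph.Walk.mem_support_iff_exists_getVert]
    constructor
    · rintro ⟨i, rfl, hi⟩
      rcases Nat.lt_or_eq_of_le hi with h | rfl
      · exact ⟨i, h, rfl⟩
      · exact ⟨0, by omega, by simp⟩
    · rintro ⟨i, hi, rfl⟩
      exact ⟨i, rfl, hi.le⟩

/-- If `A` and `B` are not joined by edges and only `q` lies outside `A ∪ B` on a cycle, then the
cycle cannot meet both `A` and `B`: deleting `q` leaves a path, which stays on one side. -/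
theorem IsCycleSeq.not_both_sides {A B : Finset V} {q : V} {f : ℕ → V} {L : ℕ}
    (hf : IsCycleSeq G f L) (hAB : Disjoint A B) (hn : ∀ a ∈ A, ∀ b ∈ B, ¬ G.Adj a b)
    (hq : ∀ i < L, f i ≠ q → f i ∈ A ∨ f i ∈ B)
    {i j : ℕ} (hi : i < L) (hj : j < L) (hiA : f i ∈ A) (hjB : f j ∈ B) : False := by
  have h3 := hf.three_le
  obtain ⟨g, hg, hg0, hgf, hfg⟩ : ∃ g, IsCycleSeq G g L ∧ (∀ i, 1 ≤ i → i < L → g i ≠ q) ∧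
      (∀ i < L, ∃ j < L, g i = f j) ∧ ∀ i < L, ∃ j < L, g j = f i := by
    by_cases h : ∃ r < L, f r = q
    · obtain ⟨r, hr, hrq⟩ := h
      obtain ⟨g, hg, hg0, -, h1, h2⟩ := hf.exists_rotate hr
      refine ⟨g, hg, fun i hi1 hiL e => ?_, h1, h2⟩
      have := hg.inj i hiL 0 (by omega) (by rw [e, hg0, hrq])
      omega
    · push Not at h
      exact ⟨f, hf, fun i _ hi => h i hi, fun i hi => ⟨i, hi, rfl⟩, fun i hi => ⟨i, hi, rfl⟩⟩
  have hside : ∀ i < L, g i ≠ q → g i ∈ A ∨ g i ∈ B := fun i hi h => by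
    obtain ⟨j, hj, e⟩ := hgf i hi
    rw [e] at h ⊢
    exact hq j hj h
  have hdisj : ∀ x, x ∈ A → x ∉ B := fun x hx => disjoint_left.1 hAB hx
  have hstep : ∀ i, i + 1 < L → g (i + 1) ≠ q → (g i ∈ A → g (i + 1) ∈ A) ∧
      (g i ∈ B → g (i + 1) ∈ B) := fun i hi h => by
    have hadj := hg.adj i hi
    rcases hside (i + 1) hi h with h' | h'
    · exact ⟨fun _ => h', fun hb => absurd hadj.symm (hn _ h' _ hb)⟩
    · exact ⟨fun ha => absurd hadj (hn _ ha _ h'), fun _ => h'⟩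
  -- all vertices but possibly the first lie on the same side as `g 1`
  have hall : ∀ i, 1 ≤ i → i < L → (g i ∈ A ↔ g 1 ∈ A) ∧ (g i ∈ B ↔ g 1 ∈ B) := by
    intro i hi
    induction i, hi using Nat.le_induction with
    | base => simp
    | succ i hi ih =>
      intro hL
      obtain ⟨e1, e2⟩ := ih (by omega)
      obtain ⟨s1, s2⟩ := hstep i hL (hg0 _ (by omega) hL)
      rw [← e1, ← e2]
      refine ⟨⟨fun h => ?_, s1⟩, ⟨fun h => ?_, s2⟩⟩
      · rcases hside i (by omega) (hg0 _ hi (by omega)) with h' | h'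
        · exact h'
        · exact absurd (s2 h') (hdisj _ h)
      · rcases hside i (by omega) (hg0 _ hi (by omega)) with h' | h'
        · exact absurd h (hdisj _ (s1 h'))
        · exact h'
  have hfirst : ∀ i < L, (g i ∈ A → g 1 ∈ A) ∧ (g i ∈ B → g 1 ∈ B) := by
    intro i hi
    rcases Nat.eq_zero_or_pos i with rfl | h
    · exact hstep 0 (by omega) (hg0 1 le_rfl (by omega))
    · exact ⟨(hall i h hi).1.1, (hall i h hi).2.1⟩
  obtain ⟨i', hi', ei⟩ := hfg i hi
  obtain ⟨j', hj', ej⟩ := hfg j hj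
  exact hdisj _ ((hfirst i' hi').1 (ei ▸ hiA)) ((hfirst j' hj').2 (ej ▸ hjB))

variable [Fintype V]

open Classical in
theorem isHForceSet_iff {X : Finset V} :
    IsHForceSet G X ↔ G.IsHamiltonian ∧ X.Nonempty ∧
      ∀ f L, IsCycleSeq G f L → (∀ x ∈ X, ∃ i < L, f i = x) → L = Fintype.card V := by
  unfold IsHForceSet
  refine and_congr Iff.rfl (and_congr Iff.rfl ⟨fun h f L hf hX => ?_, fun h a c hc hX => ?_⟩)
  · obtain ⟨a, c, hc, rfl, hs⟩ := hf.exists_walk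
    have := h a c hc fun x hx => (hs x).2 (hX x hx)
    exact this.length_eq
  · obtain ⟨hf, hs⟩ := isCycleSeq_getVert hc
    have := h _ _ hf fun x hx => (hs x).1 (hX x hx)
    rw [SimpleGraph.Walk.isHamiltonianCycle_iff_isCycle_and_length_eq]
    exact ⟨hc, this⟩

open Classical in
theorem HamOn.isHamiltonian (h : HamOn G univ) : G.IsHamiltonian := by
  intro _
  obtain ⟨f, hf, -⟩ := h
  obtain ⟨a, c, hc, hl, -⟩ := hf.exists_walk
  exact ⟨a, c, SimpleGraph.Walk.isHamiltonianCycle_iff_isCycle_and_length_eq.2 ⟨hc, hl⟩⟩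

/-- An `H`-force set is not contained in the vertex set of a non-Hamiltonian cycle. -/
theorem IsHForceSet.not_subset {X s : Finset V} (hX : IsHForceSet G X) (hs : HamOn G s)
    (hlt : #s < Fintype.card V) : ¬ X ⊆ s := by
  intro hXs
  obtain ⟨f, hf, hmem⟩ := hs
  have := (isHForceSet_iff.1 hX).2.2 f #s hf fun x hx => exists_index hf.inj hmem (hXs hx)
  omega

open Classical in
theorem IsHForceSet.mem_of_hamOn_erase {X : Finset V} {v : V} (hX : IsHForceSet G X)
    (hv : HamOn G (univ.erase v)) : v ∈ X := by
  by_contra h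
  refine hX.not_subset hv ?_ fun x hx => mem_erase.2 ⟨?_, mem_univ x⟩
  · exact card_lt_card (erase_ssubset (mem_univ v))
  · rintro rfl; exact h hx

theorem hForceNumber_eq {k : ℕ} {X : Finset V} (hX : IsHForceSet G X) (hk : #X = k)
    (h : ∀ Y, IsHForceSet G Y → k ≤ #Y) : hForceNumber G = k := by
  refine le_antisymm (Nat.sInf_le ⟨X, hX, hk⟩) (le_csInf ⟨k, X, hX, hk⟩ ?_)
  rintro _ ⟨Y, hY, rfl⟩
  exact h Y hY

theorem IsPathSeq.le_card {f : ℕ → V} {L : ℕ} (hf : IsPathSeq G f L) : L ≤ Fintype.card V := by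
  simpa using Fintype.card_le_of_injective (fun i : Fin L => f i) fun i j e =>
    Fin.ext (hf.inj i i.2 j j.2 e)

open Classical in
theorem isHForceSet_univ [Nonempty V] (h : G.IsHamiltonian) : IsHForceSet G univ := by
  refine isHForceSet_iff.2 ⟨h, univ_nonempty, fun f L hf hX => le_antisymm hf.le_card ?_⟩
  choose i hi hfi using fun x => hX x (mem_univ x)
  simpa using Fintype.card_le_of_injective (fun x => (⟨i x, hi x⟩ : Fin L)) fun x y e => by
    simp only [Fin.mk.injEq] at e
    rw [← hfi x, ← hfi y, e]

open Classical in
/-- A cycle through an independent set of `n / 2` vertices alternates, hence is Hamiltonian. -/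
theorem isHForceSet_of_independent {I : Finset V} (h : G.IsHamiltonian) (hne : I.Nonempty)
    (hI : 2 * #I = Fintype.card V) (hind : ∀ u ∈ I, ∀ w ∈ I, ¬ G.Adj u w) :
    IsHForceSet G I := by
  refine isHForceSet_iff.2 ⟨h, hne, fun f L hf hX => le_antisymm hf.le_card ?_⟩
  have h1 : 2 * #{i ∈ range L | f i ∈ I} ≤ L := by
    convert (two_mul_card_le_of_no_consecutive (L := L) (p := fun i => f i ∈ I)
      fun i hi h1 h2 => hind _ h2 _ h1 (hf.adj_cpred hi)).1
  have h2 : #{i ∈ range L | f i ∈ I} = #I := by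
    refine card_bij (fun i _ => f i) (fun i hi => (mem_filter.1 hi).2) (fun i hi j hj e => ?_)
      fun v hv => ?_
    · simp only [mem_filter, mem_range] at hi hj
      exact hf.inj _ hi.1 _ hj.1 e
    · obtain ⟨i, hi, rfl⟩ := hX v hv
      exact ⟨i, by simp [hi, hv], rfl⟩
  omega

end Force

/-! ### Intrinsic descriptions of the graph families -/

section Families

variable {V : Type*} {G : SimpleGraph V}

theorem exists_fin_enumeration (A : Finset V) {a : ℕ} (h : #A = a) :
    ∃ g : Fin a → V, Function.Injective g ∧ ∀ i, g i ∈ A := by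
  subst h
  exact ⟨fun i => A.equivFin.symm i, fun i j e => A.equivFin.symm.injective (Subtype.ext e),
    fun i => (A.equivFin.symm i).2⟩

variable [Fintype V]

/-- The graph consists of two disjoint cliques `A` and `B`, no edges between them, and two further
vertices that are adjacent to all others. -/
def TwoCliques (G : SimpleGraph V) (A B : Finset V) : Prop :=
  Disjoint A B ∧ Fintype.card V = #A + #B + 2 ∧
    ∀ u w, u ≠ w → (G.Adj u w ↔ ¬ ((u ∈ A ∧ w ∈ B) ∨ (u ∈ B ∧ w ∈ A)))

/-- The graph is complete except that `I`, containing half of the vertices, is independent. -/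
def SplitHalf (G : SimpleGraph V) (I : Finset V) : Prop :=
  Fintype.card V = 2 * #I ∧ ∀ u w, u ≠ w → (G.Adj u w ↔ ¬ (u ∈ I ∧ w ∈ I))

/-- The graph is complete bipartite with parts `I` and its complement, of the same size. -/
def BipHalf (G : SimpleGraph V) (I : Finset V) : Prop :=
  Fintype.card V = 2 * #I ∧ ∀ u w, G.Adj u w ↔ ¬ (u ∈ I ↔ w ∈ I)

/-- The vertices of `M` are universal, and all others have degree `n / 2`. -/
def HalfRegularOff (G : SimpleGraph V) (M : Finset V) : Prop :=
  2 * #M < Fintype.card V ∧ (∀ u ∈ M, ∀ w, u ≠ w → G.Adj u w) ∧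
    ∀ z ∉ M, 2 * degIn G univ z = Fintype.card V

theorem degree_eq_degIn (v : V) [Fintype (G.neighborSet v)] : G.degree v = degIn G univ v := by
  classical
  unfold degIn
  rw [← G.card_neighborFinset_eq_degree]
  congr 1
  ext w
  simp

theorem degIn_iso {W : Type*} [Fintype W] {H : SimpleGraph W} (e : G ≃g H) (v : V) :
    degIn H univ (e v) = degIn G univ v := by
  classical
  symm
  refine card_bij (fun w _ => e w) (fun w hw => ?_) (fun _ _ _ _ h => e.injective h) fun w hw => ?_
  · simpa [e.map_adj_iff] using hw
  · obtain ⟨w, rfl⟩ := e.surjective w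
    exact ⟨w, by simpa [e.map_adj_iff] using hw, rfl⟩

/-- A parametrization of all vertices of `G` by those of `H`, preserving adjacency in both
directions, is an isomorphism as soon as it is injective and the numbers of vertices agree. -/
theorem exists_iso_of_injective {W : Type*} [Fintype W] {H : SimpleGraph W} (g : W → V)
    (hg : Function.Injective g) (hc : Fintype.card W = Fintype.card V)
    (hadj : ∀ s t, G.Adj (g s) (g t) ↔ H.Adj s t) : ∃ e : G ≃g H, ∀ s, e (g s) = s := by
  have hb : Function.Bijective g := (Fintype.bijective_iff_injective_and_card g).2 ⟨hg, hc⟩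
  exact ⟨SimpleGraph.Iso.symm ⟨Equiv.ofBijective g hb, fun {s t} => hadj s t⟩,
    fun s => (Equiv.ofBijective g hb).symm_apply_apply s⟩

theorem join_adj_iff {U W : Type*} (H : SimpleGraph U) (H' : SimpleGraph W) (s t : U ⊕ W) :
    (join H H').Adj s t ↔ (H ⊕g H').Adj s t ∨ (completeBipartiteGraph U W).Adj s t := Iff.rfl

theorem nonempty_iso_join_two_cliques_iff {a b : ℕ} :
    Nonempty (G ≃g join (K 2) (K a ⊕g K b)) ↔
      ∃ A B : Finset V, #A = a ∧ #B = b ∧ TwoCliques G A B := by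
  classical
  constructor
  · rintro ⟨e⟩
    have hc := Fintype.card_congr e.toEquiv
    simp only [Fintype.card_sum, Fintype.card_fin] at hc
    have hA : #((univ : Finset (Fin a)).image fun i => e.symm (Sum.inr (Sum.inl i))) = a := by
      rw [card_image_of_injective _ fun i j h => by simpa using h]; simp
    have hB : #((univ : Finset (Fin b)).image fun i => e.symm (Sum.inr (Sum.inr i))) = b := by
      rw [card_image_of_injective _ fun i j h => by simpa using h]; simp
    refine ⟨_, _, hA, hB, ?_, by omega, fun u w huw => ?_⟩
    · rw [disjoint_left]
      intro x hx hx'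
      simp only [mem_image, mem_univ, true_and] at hx hx'
      obtain ⟨i, rfl⟩ := hx
      obtain ⟨j, h⟩ := hx'
      simp at h
    · obtain ⟨s, rfl⟩ := e.symm.surjective u
      obtain ⟨t, rfl⟩ := e.symm.surjective w
      have hst : s ≠ t := fun h => huw (by rw [h])
      rw [e.symm.map_adj_iff, join_adj_iff]
      rcases s with s | s | s <;> rcases t with t | t | t <;> simp_all
  · rintro ⟨A, B, hA, hB, hd, hc, hadj⟩
    obtain ⟨gA, hgA, hgA'⟩ := exists_fin_enumeration A hA
    obtain ⟨gB, hgB, hgB'⟩ := exists_fin_enumeration B hB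
    have hP : #((A ∪ B)ᶜ) = 2 := by
      rw [card_compl, card_union_of_disjoint hd]; omega
    obtain ⟨gP, hgP, hgP'⟩ := exists_fin_enumeration _ hP
    have hPA : ∀ i, gP i ∉ A := fun i h => by have := hgP' i; simp [h] at this
    have hPB : ∀ i, gP i ∉ B := fun i h => by have := hgP' i; simp [h] at this
    have hAB : ∀ i, gA i ∉ B := fun i => disjoint_left.1 hd (hgA' i)
    have hBA : ∀ i, gB i ∉ A := fun i => disjoint_right.1 hd (hgB' i)
    have hinj : Function.Injective (Sum.elim gP (Sum.elim gA gB)) := by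
      refine hgP.sumElim (hgA.sumElim hgB fun i j h => hAB i (h ▸ hgB' j)) ?_
      rintro i (j | j) h
      · exact hPA i (by rw [h]; exact hgA' j)
      · exact hPB i (by rw [h]; exact hgB' j)
    refine (exists_iso_of_injective _ hinj (by simp; omega) fun s t => ?_).nonempty
    by_cases hst : s = t
    · subst hst; simp
    rw [hadj _ _ (hinj.ne hst), join_adj_iff]
    rcases s with s | s | s <;> rcases t with t | t | t <;>
      simp [hPA, hPB, hAB, hBA, hgA', hgB'] <;> simpa using hst

theorem nonempty_iso_split_iff {k : ℕ} (hk : Fintype.card V = 2 * k) :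
    Nonempty (G ≃g join (Kc k) (K k)) ↔ ∃ I : Finset V, SplitHalf G I := by
  classical
  constructor
  · rintro ⟨e⟩
    have hI : #((univ : Finset (Fin k)).image fun i => e.symm (Sum.inl i)) = k := by
      rw [card_image_of_injective _ fun i j h => by simpa using h]; simp
    refine ⟨_, by rw [hI, hk], fun u w huw => ?_⟩
    obtain ⟨s, rfl⟩ := e.symm.surjective u
    obtain ⟨t, rfl⟩ := e.symm.surjective w
    have hst : s ≠ t := fun h => huw (by rw [h])
    rw [e.symm.map_adj_iff, join_adj_iff]
    rcases s with s | s <;> rcases t with t | t <;> simp_all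
  · rintro ⟨I, hc, hadj⟩
    obtain ⟨gI, hgI, hgI'⟩ := exists_fin_enumeration I (show #I = k by omega)
    have hJ : #(Iᶜ) = k := by rw [card_compl]; omega
    obtain ⟨gJ, hgJ, hgJ'⟩ := exists_fin_enumeration _ hJ
    have hJI : ∀ i, gJ i ∉ I := fun i => by simpa using hgJ' i
    have hinj : Function.Injective (Sum.elim gI gJ) :=
      hgI.sumElim hgJ fun i j h => hJI j (h ▸ hgI' i)
    refine (exists_iso_of_injective _ hinj (by simp; omega) fun s t => ?_).nonempty
    by_cases hst : s = t
    · subst hst; simp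
    rw [hadj _ _ (hinj.ne hst), join_adj_iff]
    rcases s with s | s <;> rcases t with t | t <;> simp_all

theorem nonempty_iso_bip_iff {k : ℕ} (hk : Fintype.card V = 2 * k) :
    Nonempty (G ≃g Kbip k) ↔ ∃ I : Finset V, BipHalf G I := by
  classical
  constructor
  · rintro ⟨e⟩
    have hI : #((univ : Finset (Fin k)).image fun i => e.symm (Sum.inl i)) = k := by
      rw [card_image_of_injective _ fun i j h => by simpa using h]; simp
    refine ⟨_, by rw [hI, hk], fun u w => ?_⟩
    obtain ⟨s, rfl⟩ := e.symm.surjective u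
    obtain ⟨t, rfl⟩ := e.symm.surjective w
    rw [e.symm.map_adj_iff]
    rcases s with s | s <;> rcases t with t | t <;> simp
  · rintro ⟨I, hc, hadj⟩
    obtain ⟨gI, hgI, hgI'⟩ := exists_fin_enumeration I (show #I = k by omega)
    have hJ : #(Iᶜ) = k := by rw [card_compl]; omega
    obtain ⟨gJ, hgJ, hgJ'⟩ := exists_fin_enumeration _ hJ
    have hJI : ∀ i, gJ i ∉ I := fun i => by simpa using hgJ' i
    have hinj : Function.Injective (Sum.elim gI gJ) :=
      hgI.sumElim hgJ fun i j h => hJI j (h ▸ hgI' i)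
    refine (exists_iso_of_injective _ hinj (by simp; omega) fun s t => ?_).nonempty
    rw [hadj]
    rcases s with s | s <;> rcases t with t | t <;> simp_all

open Classical in
theorem exists_iso_join_regular_iff {k : ℕ} (hk : Fintype.card V = 2 * k) :
    (∃ m : ℕ, m < k ∧ ∃ Z : SimpleGraph (Fin (Fintype.card V - m)),
      (∀ z, (join Z (K m)).degree (Sum.inl z) = k) ∧ Nonempty (G ≃g join Z (K m))) ↔
    ∃ M : Finset V, HalfRegularOff G M := by
  constructor
  · rintro ⟨m, hm, Z, hZ, ⟨e⟩⟩
    have hM : #((univ : Finset (Fin m)).image fun i => e.symm (Sum.inr i)) = m := by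
      rw [card_image_of_injective _ fun i j h => by simpa using h]; simp
    refine ⟨_, by rw [hM, hk]; omega, fun u hu w huw => ?_, fun z hz => ?_⟩
    · obtain ⟨s, rfl⟩ := e.symm.surjective u
      obtain ⟨t, rfl⟩ := e.symm.surjective w
      have hst : s ≠ t := fun h => huw (by rw [h])
      rw [e.symm.map_adj_iff, join_adj_iff]
      rcases s with s | s <;> rcases t with t | t <;> simp_all
    · obtain ⟨s, rfl⟩ := e.symm.surjective z
      rcases s with s | s
      · rw [degIn_iso, ← degree_eq_degIn, hZ, hk]
      · simp at hz
  · rintro ⟨M, hMc, hM, hdeg⟩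
    have hJ : #(Mᶜ) = Fintype.card V - #M := by rw [card_compl]
    obtain ⟨gI, hgI, hgI'⟩ := exists_fin_enumeration M rfl
    obtain ⟨gJ, hgJ, hgJ'⟩ := exists_fin_enumeration _ hJ
    have hJI : ∀ i, gJ i ∉ M := fun i => by simpa using hgJ' i
    have hinj : Function.Injective (Sum.elim gJ gI) :=
      hgJ.sumElim hgI fun i j h => hJI i (h ▸ hgI' j)
    obtain ⟨e, he⟩ : ∃ e : G ≃g join (G.comap gJ) (K #M), ∀ s, e (Sum.elim gJ gI s) = s := by
      refine exists_iso_of_injective _ hinj (by simp; omega) fun s t => ?_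
      by_cases hst : s = t
      · subst hst; simp
      rw [join_adj_iff]
      have hne := hinj.ne hst
      rcases s with s | s <;> rcases t with t | t
      · simp
      · simpa using (hM _ (hgI' t) _ hne.symm).symm
      · simpa using hM _ (hgI' s) _ hne
      · simpa [show s ≠ t by rintro rfl; exact hst rfl] using hM _ (hgI' s) _ hne
    refine ⟨#M, by omega, G.comap gJ, fun z => ?_, ⟨e⟩⟩
    have h1 := degIn_iso e (gJ z)
    rw [show e (gJ z) = Sum.inl z from he (Sum.inl z)] at h1
    rw [degree_eq_degIn, h1]
    have := hdeg _ (hJI z)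
    omega

end Families

/-! ### Classification of the weak closures -/

section Classification

variable {V : Type*} [Fintype V] {G : SimpleGraph V}

/-- Any two distinct nonadjacent vertices have degree sum exactly `n`. -/
def OreTight (G : SimpleGraph V) : Prop :=
  ∀ u w, u ≠ w → ¬ G.Adj u w → degIn G univ u + degIn G univ w = Fintype.card V

theorem IsOTG.of_weakStep {G' : SimpleGraph V} (h : WeakStep G G') (hG : IsOTG G) : IsOTG G' := by
  obtain ⟨x, y, -, rfl⟩ := h
  intro u v huv hn
  have h1 := hG u v huv fun h => hn (Or.inl h)
  simp only [degree_eq_degIn] at h1 ⊢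
  have h2 := degIn_mono (le_sup_left : G ≤ G ⊔ SimpleGraph.edge x y) univ u
  have h3 := degIn_mono (le_sup_left : G ≤ G ⊔ SimpleGraph.edge x y) univ v
  omega

theorem mem_weakClosures_iff : G ∈ weakClosures V ↔ OreTight G := by
  constructor
  · rintro ⟨G₀, h₀, hcl, hj⟩ u w huw hn
    have hG : IsOTG G := by
      clear hj hn
      induction hcl with
      | refl => exact h₀
      | tail _ h ih => exact ih.of_weakStep h
    have h1 := hG u w huw hn
    have h2 := hj u w
    simp only [Joinable, degree_eq_degIn] at h1 h2
    by_contra h3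
    exact h2 ⟨huw, hn, by omega⟩
  · intro h
    refine ⟨G, fun u w huw hn => ?_, .refl, ?_⟩
    · simp only [degree_eq_degIn]
      exact (h u w huw hn).ge
    · rintro u w ⟨huw, hn, hd⟩
      simp only [degree_eq_degIn] at hd
      have := h u w huw hn
      omega

open Classical in
theorem degIn_add_card_nonadj (u : V) :
    degIn G univ u + #{w | w ≠ u ∧ ¬ G.Adj u w} + 1 = Fintype.card V := by
  have h1 := card_filter_add_card_filter_not (s := (univ : Finset V)) (fun w => G.Adj u w)
  have h2 : {w ∈ (univ : Finset V) | ¬ G.Adj u w} =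
      insert u {w ∈ (univ : Finset V) | w ≠ u ∧ ¬ G.Adj u w} := by
    ext w
    by_cases h : w = u <;> simp [h]
  rw [h2, card_insert_of_notMem (by simp), card_univ] at h1
  unfold degIn
  omega

theorem degIn_eq_of_nonadj_iff {u : V} {S : Finset V} (h : ∀ w, w ∈ S ↔ w ≠ u ∧ ¬ G.Adj u w) :
    degIn G univ u + #S + 1 = Fintype.card V := by
  classical
  rw [← degIn_add_card_nonadj (G := G) u]
  congr 3
  ext w; simp [h]

theorem degIn_add_card_le {u : V} {S : Finset V} (h : ∀ w ∈ S, w ≠ u ∧ ¬ G.Adj u w) :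
    degIn G univ u + #S + 1 ≤ Fintype.card V := by
  classical
  rw [← degIn_add_card_nonadj (G := G) u]
  gcongr
  intro w hw
  simpa using h w hw

theorem TwoCliques.degIn_left {A B : Finset V} (h : TwoCliques G A B) {u : V} (hu : u ∈ A) :
    degIn G univ u + #B + 1 = Fintype.card V := by
  have hd := h.1
  refine degIn_eq_of_nonadj_iff fun w => ⟨fun hw => ?_, fun ⟨h1, h2⟩ => ?_⟩
  · have : w ≠ u := by rintro rfl; exact disjoint_left.1 hd hu hw
    exact ⟨this, by rw [h.2.2 u w this.symm]; tauto⟩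
  · rw [h.2.2 u w h1.symm] at h2
    have := fun hw : u ∈ B => disjoint_left.1 hd hu hw
    tauto

theorem TwoCliques.symm {A B : Finset V} (h : TwoCliques G A B) : TwoCliques G B A :=
  ⟨h.1.symm, by have := h.2.1; omega, fun u w huw => by rw [h.2.2 u w huw]; tauto⟩

theorem TwoCliques.oreTight {A B : Finset V} (h : TwoCliques G A B) : OreTight G := by
  intro u w huw hn
  have hc := h.2.1
  rw [h.2.2 u w huw, not_not] at hn
  rcases hn with ⟨hu, hw⟩ | ⟨hu, hw⟩
  · have := h.degIn_left hu
    have := h.symm.degIn_left hw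
    omega
  · have := h.degIn_left hw
    have := h.symm.degIn_left hu
    omega

theorem SplitHalf.degIn_eq {I : Finset V} (h : SplitHalf G I) {u : V} (hu : u ∈ I) :
    degIn G univ u = #I := by
  classical
  have := degIn_eq_of_nonadj_iff (G := G) (u := u) (S := I.erase u) fun w => by
    rw [mem_erase]
    refine and_congr_right fun hw => ?_
    rw [h.2 u w (Ne.symm hw)]; tauto
  have h1 := card_erase_add_one hu
  have := h.1
  omega

theorem BipHalf.compl [DecidableEq V] {I : Finset V} (h : BipHalf G I) : BipHalf G Iᶜ := by
  refine ⟨by have := h.1; rw [card_compl]; omega, fun u w => ?_⟩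
  rw [h.2, mem_compl, mem_compl]; tauto

theorem BipHalf.degIn_eq {I : Finset V} (h : BipHalf G I) (u : V) : degIn G univ u = #I := by
  classical
  wlog hu : u ∈ I generalizing I
  · rw [this h.compl (mem_compl.2 hu)]
    have := h.1
    rw [card_compl]; omega
  have := degIn_eq_of_nonadj_iff (G := G) (u := u) (S := I.erase u) fun w => by
    rw [mem_erase, h.2]; tauto
  have h1 := card_erase_add_one hu
  have := h.1
  omega

theorem SplitHalf.oreTight {I : Finset V} (h : SplitHalf G I) : OreTight G := by
  intro u w huw hn
  rw [h.2 u w huw, not_not] at hn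
  rw [h.degIn_eq hn.1, h.degIn_eq hn.2, h.1]
  omega

theorem BipHalf.oreTight {I : Finset V} (h : BipHalf G I) : OreTight G := by
  intro u w _ _
  rw [h.degIn_eq, h.degIn_eq, h.1]
  omega

theorem HalfRegularOff.oreTight {M : Finset V} (h : HalfRegularOff G M) : OreTight G := by
  intro u w huw hn
  have h1 := h.2.2 u fun hu => hn (h.2.1 u hu w huw)
  have h2 := h.2.2 w fun hw => hn (h.2.1 w hw u huw.symm).symm
  omega

open Classical in
/-- If some nonadjacent pair has degrees `d < n - d`, then the vertices of degrees `d` and `n - d`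
form the two cliques: counting the non-edges between the two classes in two ways leaves exactly two
further vertices. -/
theorem OreTight.twoCliques (h : OreTight G) (hn : 5 ≤ Fintype.card V) {x y : V} (hxy : x ≠ y)
    (hadj : ¬ G.Adj x y) (hlt : degIn G univ x < degIn G univ y) :
    TwoCliques G {u | degIn G univ u = degIn G univ x} {u | degIn G univ u = degIn G univ y} := by
  have hsum := h x y hxy hadj
  have hnx := degIn_add_card_nonadj (G := G) x
  have hny := degIn_add_card_nonadj (G := G) y
  have hy0 : 0 < #{w | w ≠ y ∧ ¬ G.Adj y w} :=
    card_pos.2 ⟨x, by simp [hxy, G.adj_comm y x, hadj]⟩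
  set d := degIn G univ x with hd
  set e := degIn G univ y with he
  set A : Finset V := {u | degIn G univ u = d} with hA
  set B : Finset V := {u | degIn G univ u = e} with hB
  have mA : ∀ u, u ∈ A ↔ degIn G univ u = d := fun u => by simp [hA]
  have mB : ∀ u, u ∈ B ↔ degIn G univ u = e := fun u => by simp [hB]
  have hAB : Disjoint A B := by
    rw [disjoint_left]
    intro u hu hu'
    rw [mA] at hu; rw [mB] at hu'
    omega
  have nA : ∀ a ∈ A, ∀ w, a ≠ w → ¬ G.Adj a w → w ∈ B := fun a ha w haw hn => by
    have := h a w haw hn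
    rw [mA] at ha; rw [mB]; omega
  have nB : ∀ b ∈ B, ∀ w, b ≠ w → ¬ G.Adj b w → w ∈ A := fun a ha w haw hn => by
    have := h a w haw hn
    rw [mB] at ha; rw [mA]; omega
  have cA : ∀ a ∈ A, #{b ∈ B | ¬ G.Adj a b} + d + 1 = Fintype.card V := fun a ha => by
    have := degIn_eq_of_nonadj_iff (G := G) (u := a) (S := {b ∈ B | ¬ G.Adj a b}) fun w => by
      rw [mem_filter]
      refine ⟨fun hw => ⟨?_, hw.2⟩, fun hw => ⟨nA a ha w hw.1.symm hw.2, hw.2⟩⟩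
      rintro rfl
      exact disjoint_left.1 hAB ha hw.1
    rw [mA] at ha
    omega
  have cB : ∀ b ∈ B, #{a ∈ A | ¬ G.Adj a b} + e + 1 = Fintype.card V := fun b hb => by
    have := degIn_eq_of_nonadj_iff (G := G) (u := b) (S := {a ∈ A | ¬ G.Adj a b}) fun w => by
      rw [mem_filter, G.adj_comm]
      refine ⟨fun hw => ⟨?_, hw.2⟩, fun hw => ⟨nB b hb w hw.1.symm hw.2, hw.2⟩⟩
      rintro rfl
      exact disjoint_left.1 hAB hw.1 hb
    rw [mB] at hb
    omega
  have xA : x ∈ A := (mA x).2 rfl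
  have yB : y ∈ B := (mB y).2 rfl
  have hcount : #A * (e - 1) = #B * (d - 1) :=
    card_mul_eq_card_mul (fun a b => ¬ G.Adj a b)
      (fun a ha => by have := cA a ha; change #{b ∈ B | ¬ G.Adj a b} = _; omega)
      (fun b hb => by have := cB b hb; change #{a ∈ A | ¬ G.Adj a b} = _; omega)
  have hA' : d - 1 ≤ #A := by
    have := cB y yB
    have := card_le_card (filter_subset (fun a => ¬ G.Adj a y) A)
    omega
  have hB' : e - 1 ≤ #B := by
    have := cA x xA
    have := card_le_card (filter_subset (fun b => ¬ G.Adj x b) B)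
    omega
  have hle : #A + #B ≤ Fintype.card V := by
    rw [← card_union_of_disjoint hAB]; exact card_le_univ _
  obtain ⟨α, hα⟩ := Nat.exists_eq_add_of_le hA'
  obtain ⟨β, hβ⟩ := Nat.exists_eq_add_of_le hB'
  -- with `#A = d - 1 + α` and `#B = e - 1 + β` the count reads `α (e - 1) = β (d - 1)`
  have hαβ : α = 0 ∧ β = 0 := by
    have h1 : α * (e - 1) = β * (d - 1) := by
      rw [hα, hβ] at hcount
      nlinarith
    have h2 : α + β ≤ 2 := by omega
    have h3 : α ≤ 2 := by omega
    have h4 : β ≤ 2 := by omega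
    interval_cases α <;> interval_cases β <;> omega
  obtain ⟨rfl, rfl⟩ := hαβ
  have hcard : Fintype.card V = #A + #B + 2 := by omega
  have full : ∀ a ∈ A, ∀ b ∈ B, ¬ G.Adj a b := fun a ha b hb => by
    have h1 := cA a ha
    have h2 := eq_of_subset_of_card_le (filter_subset (fun b => ¬ G.Adj a b) B) (by omega)
    rw [← h2] at hb
    exact (mem_filter.1 hb).2
  refine ⟨hAB, hcard, fun u w huw => ⟨fun hadj hc => ?_, fun hc => ?_⟩⟩
  · rcases hc with ⟨hu, hw⟩ | ⟨hu, hw⟩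
    · exact full u hu w hw hadj
    · exact full w hw u hu hadj.symm
  · by_contra hn'
    by_cases huA : u ∈ A
    · exact hc (Or.inl ⟨huA, nA u huA w huw hn'⟩)
    by_cases huB : u ∈ B
    · exact hc (Or.inr ⟨huB, nB u huB w huw hn'⟩)
    have hwA : w ∉ A := fun hw => huB (nA w hw u huw.symm fun h => hn' h.symm)
    have hwB : w ∉ B := fun hw => huA (nB w hw u huw.symm fun h => hn' h.symm)
    -- both `u` and `w` are adjacent to all of `A ∪ B`, so their degree sum is too large
    have big : ∀ v, v ∉ A → v ∉ B → #A + #B ≤ degIn G univ v := fun v hvA hvB => by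
      rw [← card_union_of_disjoint hAB]
      refine card_le_card fun t ht => ?_
      simp only [mem_filter, mem_univ, true_and]
      by_contra h'
      have h'' : ¬ G.Adj t v := fun h => h' h.symm
      rcases mem_union.1 ht with ht | ht
      · exact hvB (nA t ht v (by rintro rfl; exact hvA ht) h'')
      · exact hvA (nB t ht v (by rintro rfl; exact hvB ht) h'')
    have := big u huA huB
    have := big w hwA hwB
    have := h u w huw hn'
    omega

/-- If no nonadjacent pair has two different degrees, then all non-universal vertices have degree
`n / 2`, and each of them is adjacent to all `m` universal ones. So `m ≤ n / 2`, and in the case of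
equality the non-universal vertices are independent. -/
theorem OreTight.classification (h : OreTight G) (hn : 5 ≤ Fintype.card V) :
    (∃ A B, A.Nonempty ∧ 2 * #A < Fintype.card V ∧ TwoCliques G A B) ∨ (∃ I, SplitHalf G I) ∨ G = ⊤ ∨
      ∃ M, HalfRegularOff G M := by
  classical
  by_cases hlt : ∃ x y, x ≠ y ∧ ¬ G.Adj x y ∧ degIn G univ x < degIn G univ y
  · obtain ⟨x, y, hxy, hadj, hd⟩ := hlt
    left
    have hT := h.twoCliques hn hxy hadj hd
    refine ⟨_, _, ⟨x, by simp⟩, ?_, hT⟩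
    have h1 := hT.degIn_left (u := x) (by simp)
    have h2 := hT.symm.degIn_left (u := y) (by simp)
    have h3 := hT.2.1
    omega
  right
  have hhalf : ∀ x y, x ≠ y → ¬ G.Adj x y → 2 * degIn G univ x = Fintype.card V := by
    intro x y hxy hadj
    have h1 := h x y hxy hadj
    by_contra h2
    rcases lt_or_gt_of_ne (show degIn G univ x ≠ degIn G univ y by omega) with h3 | h3
    · exact hlt ⟨x, y, hxy, hadj, h3⟩
    · exact hlt ⟨y, x, hxy.symm, fun h => hadj h.symm, h3⟩
  let M : Finset V := {x | ∀ w, x ≠ w → G.Adj x w}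
  have hM : ∀ u ∈ M, ∀ w, u ≠ w → G.Adj u w := fun u hu => by simpa [M] using hu
  have hz : ∀ z ∉ M, 2 * degIn G univ z = Fintype.card V := fun z hzM => by
    simp only [M, mem_filter, mem_univ, true_and] at hzM
    push Not at hzM
    obtain ⟨w, hw1, hw2⟩ := hzM
    exact hhalf z w hw1 hw2
  by_cases hall : ∃ z, z ∉ M
  swap
  · right; left
    push Not at hall
    ext u w
    exact ⟨fun h => h.ne, fun h => hM u (hall u) w h⟩
  obtain ⟨z, hzM⟩ := hall
  have hsub : ∀ z ∉ M, M ⊆ ({w | G.Adj z w} : Finset V) := fun z hzM u hu => by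
    simp only [mem_filter, mem_univ, true_and]
    exact (hM u hu z (by rintro rfl; exact hzM hu)).symm
  have hle : #M ≤ degIn G univ z := card_le_card (hsub z hzM)
  have h2 := hz z hzM
  by_cases heq : 2 * #M = Fintype.card V
  · left
    refine ⟨Mᶜ, by rw [card_compl]; omega, fun u w huw => ?_⟩
    simp only [mem_compl]
    constructor
    · rintro hadj ⟨hu, hw⟩
      have := eq_of_subset_of_card_le (hsub u hu) (by
        have := hz u hu; unfold degIn at this; omega)
      apply hw
      rw [this]
      simpa using hadj
    · intro hc
      by_cases hu : u ∈ M
      · exact hM u hu w huw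
      · exact (hM w (by by_contra hw; exact hc ⟨hu, hw⟩) u huw.symm).symm
  · exact Or.inr (Or.inr ⟨M, by omega, hM, hz⟩)

end Classification

/-! ### Force numbers of the families -/

section ForceNumbers

variable {V : Type*} {G : SimpleGraph V}

theorem degIn_le_degIn_erase_add_one [DecidableEq V] (s : Finset V) (u v : V) :
    degIn G s u ≤ degIn G (s.erase v) u + 1 := by
  classical
  unfold degIn
  rw [filter_erase]
  have := pred_card_le_card_erase (s := {w ∈ s | G.Adj u w}) (a := v)
  omega

theorem degIn_erase_of_not_adj [DecidableEq V] (s : Finset V) {u v : V} (h : ¬ G.Adj u v) :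
    degIn G (s.erase v) u = degIn G s u := by
  classical
  unfold degIn
  rw [filter_erase, erase_eq_of_notMem]
  simp [h]

variable [Fintype V]

theorem OreTight.hamOn_univ (h : OreTight G) (hn : 3 ≤ Fintype.card V) : HamOn G univ :=
  hamOn_of_ore (by rwa [card_univ]) fun u _ w _ huw hadj => by
    rw [card_univ]; exact (h u w huw hadj).ge

/-- If no nonadjacent pair lies in the neighbourhood of `v`, deleting `v` lowers each relevant
degree sum by at most one, so Ore's condition survives. -/
theorem OreTight.hamOn_erase [DecidableEq V] (h : OreTight G) (hn : 4 ≤ Fintype.card V) {v : V}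
    (hv : ∀ u w, u ≠ w → ¬ G.Adj u w → ¬ G.Adj u v ∨ ¬ G.Adj w v) :
    HamOn G (univ.erase v) := by
  have hc : #(univ.erase v) + 1 = Fintype.card V := by
    rw [card_erase_add_one (mem_univ v), card_univ]
  refine hamOn_of_ore (by omega) fun u _ w _ huw hadj => ?_
  have h1 := h u w huw hadj
  have h2 := degIn_le_degIn_erase_add_one (G := G) univ u v
  have h3 := degIn_le_degIn_erase_add_one (G := G) univ w v
  rcases hv u w huw hadj with h4 | h4
  · have := degIn_erase_of_not_adj univ h4
    omega
  · have := degIn_erase_of_not_adj univ h4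
    omega

theorem TwoCliques.hForceNumber_eq {A B : Finset V} (h : TwoCliques G A B) (hA : A.Nonempty)
    (hB : B.Nonempty) (hn : 5 ≤ Fintype.card V) : hForceNumber G = Fintype.card V - 2 := by
  classical
  have ⟨hd, hc, hadj⟩ := h
  have hcard : #(A ∪ B) = #A + #B := card_union_of_disjoint hd
  have hno : ∀ a ∈ A, ∀ b ∈ B, ¬ G.Adj a b := fun a ha b hb hab =>
    (hadj a b hab.ne).1 hab (Or.inl ⟨ha, hb⟩)
  refine HForce.hForceNumber_eq (X := A ∪ B) ?_ (by omega) fun Y hY => ?_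
  · refine isHForceSet_iff.2 ⟨(h.oreTight.hamOn_univ (by omega)).isHamiltonian,
      hA.mono subset_union_left, fun f L hf hX => le_antisymm hf.le_card ?_⟩
    obtain ⟨a, ha⟩ := hA
    obtain ⟨b, hb⟩ := hB
    obtain ⟨i, hi, rfl⟩ := hX a (mem_union_left _ ha)
    obtain ⟨j, hj, rfl⟩ := hX b (mem_union_right _ hb)
    -- a vertex outside `A ∪ B` missing from the cycle leaves at most one cut vertex on it
    have hall : ∀ p, ∃ i < L, f i = p := by
      intro p
      by_cases hp : p ∈ A ∪ B
      · exact hX p hp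
      by_contra hpf
      push Not at hpf
      have hP : #((A ∪ B)ᶜ.erase p) = 1 := by
        rw [card_erase_of_mem (mem_compl.2 hp), card_compl]
        omega
      obtain ⟨q, hq⟩ := card_eq_one.1 hP
      refine hf.not_both_sides (q := q) hd hno (fun t ht htq => ?_) hi hj ha hb
      by_contra htAB
      have : f t ∈ (A ∪ B)ᶜ.erase p :=
        mem_erase.2 ⟨hpf t ht, mem_compl.2 fun h => htAB (mem_union.1 h)⟩
      rw [hq, mem_singleton] at this
      exact htq this
    choose t ht hft using hall
    simpa using Fintype.card_le_of_injective (fun x => (⟨t x, ht x⟩ : Fin L)) fun x y e => by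
      simp only [Fin.mk.injEq] at e
      rw [← hft x, ← hft y, e]
  · have hsub : A ∪ B ⊆ Y := fun v hv => by
      refine hY.mem_of_hamOn_erase (h.oreTight.hamOn_erase (by omega) fun u w huw hn' => ?_)
      rw [hadj u w huw, not_not] at hn'
      rcases mem_union.1 hv with hv | hv <;> rcases hn' with ⟨hu, hw⟩ | ⟨hu, hw⟩
      · exact Or.inr fun h => hno _ hv _ hw h.symm
      · exact Or.inl fun h => hno _ hv _ hu h.symm
      · exact Or.inl (hno _ hu _ hv)
      · exact Or.inr (hno _ hw _ hv)
    have := card_le_card hsub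
    omega

theorem SplitHalf.hForceNumber_eq {I : Finset V} (h : SplitHalf G I)
    (hn : 5 ≤ Fintype.card V) : hForceNumber G = #I := by
  classical
  have hc := h.1
  have hI : ∀ u ∈ I, ∀ w ∈ I, ¬ G.Adj u w := fun u hu w hw hadj =>
    (h.2 u w hadj.ne).1 hadj ⟨hu, hw⟩
  refine HForce.hForceNumber_eq (X := I)
    (isHForceSet_of_independent (h.oreTight.hamOn_univ (by omega)).isHamiltonian
      (card_pos.1 (by omega)) hc.symm hI) rfl fun Y hY => card_le_card fun v hv => ?_
  refine hY.mem_of_hamOn_erase (h.oreTight.hamOn_erase (by omega) fun u w huw hn' => ?_)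
  rw [h.2 u w huw, not_not] at hn'
  exact Or.inl (hI u hn'.1 v hv)

/-- Deleting one vertex from each part of `K_{k,k}` leaves the Hamiltonian graph `K_{k-1,k-1}`. -/
theorem BipHalf.hamOn_erase_erase [DecidableEq V] {I : Finset V} (h : BipHalf G I)
    (hn : 5 ≤ Fintype.card V) {x y : V} (hx : x ∈ I) (hy : y ∉ I) :
    HamOn G ((univ.erase x).erase y) := by
  have hc := h.1
  have hyx : y ≠ x := by rintro rfl; exact hy hx
  have hcard : #((univ.erase x).erase y) + 2 = Fintype.card V := by
    have h1 := card_erase_add_one (mem_univ x)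
    have h2 := card_erase_add_one (mem_erase.2 ⟨hyx, mem_univ y⟩)
    rw [card_univ] at h1
    omega
  have hdeg : ∀ u, #I ≤ degIn G ((univ.erase x).erase y) u + 1 := fun u => by
    have h1 := h.degIn_eq u
    by_cases hu : u ∈ I
    · have h2 : ¬ G.Adj u x := by rw [h.2]; tauto
      have h3 := degIn_erase_of_not_adj univ h2
      have h4 := degIn_le_degIn_erase_add_one (G := G) (univ.erase x) u y
      omega
    · have h2 : ¬ G.Adj u y := by rw [h.2]; tauto
      have h3 := degIn_erase_of_not_adj (univ.erase x) h2
      have h4 := degIn_le_degIn_erase_add_one (G := G) univ u x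
      omega
  refine hamOn_of_ore (by omega) fun u _ w _ _ _ => ?_
  have := hdeg u
  have := hdeg w
  omega

theorem BipHalf.hForceNumber_eq {I : Finset V} (h : BipHalf G I)
    (hn : 5 ≤ Fintype.card V) : hForceNumber G = #I := by
  classical
  have hc := h.1
  refine HForce.hForceNumber_eq (X := I)
    (isHForceSet_of_independent (h.oreTight.hamOn_univ (by omega)).isHamiltonian
      (card_pos.1 (by omega)) hc.symm fun u hu w hw => by rw [h.2]; tauto) rfl fun Y hY => ?_
  by_contra hlt
  obtain ⟨x, hxI, hxY⟩ := exists_mem_notMem_of_card_lt_card (show #Y < #I by omega)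
  obtain ⟨y, hyI, hyY⟩ := exists_mem_notMem_of_card_lt_card (show #Y < #Iᶜ by
    rw [card_compl]; omega)
  rw [mem_compl] at hyI
  refine hY.not_subset (h.hamOn_erase_erase hn hxI hyI) ?_ fun v hv => ?_
  · rw [← card_univ]
    exact card_lt_card ((erase_subset _ _).trans_ssubset (erase_ssubset (mem_univ x)))
  · refine mem_erase.2 ⟨?_, mem_erase.2 ⟨?_, mem_univ v⟩⟩
    · rintro rfl; exact hyY hv
    · rintro rfl; exact hxY hv

theorem hForceNumber_eq_card [DecidableEq V] [Nonempty V] (h : HamOn G univ)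
    (he : ∀ v, HamOn G (univ.erase v)) : hForceNumber G = Fintype.card V :=
  hForceNumber_eq (isHForceSet_univ h.isHamiltonian) card_univ fun Y hY => by
    rw [← card_univ]
    exact card_le_card fun v _ => hY.mem_of_hamOn_erase (by convert he v)

theorem hForceNumber_top (hn : 5 ≤ Fintype.card V) :
    hForceNumber (⊤ : SimpleGraph V) = Fintype.card V := by
  classical
  have : Nonempty V := Fintype.card_pos_iff.1 (by omega)
  refine hForceNumber_eq_card (hamOn_of_clique (by rw [card_univ]; omega) fun u _ w _ h => h)
    fun v => hamOn_of_clique ?_ fun u _ w _ h => h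
  rw [card_erase_of_mem (mem_univ v), card_univ]; omega

/-- A set `W` of `n / 2` independent vertices forces `G = K_{n/2,n/2}`: a vertex of `W` has degree
`n / 2`, hence is adjacent to all of `Wᶜ`, and there are too few universal vertices to fill `Wᶜ`. -/
theorem HalfRegularOff.bipHalf {M W : Finset V} (h : HalfRegularOff G M)
    (hn : 5 ≤ Fintype.card V) (hW : Fintype.card V = 2 * #W)
    (hind : ∀ u ∈ W, ∀ w ∈ W, ¬ G.Adj u w) : BipHalf G W := by
  classical
  obtain ⟨hMc, hM, hdeg⟩ := h
  have hWM : ∀ u ∈ W, u ∉ M := fun u hu huM => by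
    obtain ⟨w, hw, hwu⟩ := exists_mem_ne (show 1 < #W by omega) u
    exact hind u hu w hw (hM u huM w hwu.symm)
  have hfull : ∀ u ∈ W, ∀ w ∉ W, G.Adj u w := fun u hu w hw => by
    have h1 := hdeg u (hWM u hu)
    have hsub : ({w | G.Adj u w} : Finset V) ⊆ Wᶜ := fun t ht => by
      simp only [mem_filter, mem_univ, true_and] at ht
      exact mem_compl.2 fun htW => hind u hu t htW ht
    have := eq_of_subset_of_card_le hsub (by
      unfold degIn at h1; rw [card_compl]; omega)
    have hw' := mem_compl.2 hw
    rw [← this] at hw'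
    simpa using hw'
  -- a vertex outside `W` with a further neighbour outside `W` has degree above `n / 2`
  have hmore : ∀ w ∉ W, ∀ t ∉ W, G.Adj w t → w ∈ M := fun w hw t ht hwt => by
    by_contra hwM
    have h1 := hdeg w hwM
    have : insert t W ⊆ ({v | G.Adj w v} : Finset V) := fun v hv => by
      simp only [mem_filter, mem_univ, true_and]
      rcases mem_insert.1 hv with rfl | hv
      · exact hwt
      · exact (hfull v hv w hw).symm
    have := card_le_card this
    rw [card_insert_of_notMem ht] at this
    unfold degIn at h1
    omega
  have hout : ∀ u ∉ W, ∀ w ∉ W, ¬ G.Adj u w := fun u hu w hw hadj => by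
    have huM := hmore u hu w hw hadj
    have : Wᶜ ⊆ M := fun t ht => by
      rw [mem_compl] at ht
      by_cases htu : t = u
      · exact htu ▸ huM
      · exact hmore t ht u hu (hM u huM t (Ne.symm htu)).symm
    have := card_le_card this
    rw [card_compl] at this
    omega
  refine ⟨hW, fun u w => ?_⟩
  have h1 := hind u
  have h2 := hout u
  by_cases hu : u ∈ W <;> by_cases hw : w ∈ W
  · simp [hu, hw, hind u hu w hw]
  · simp [hu, hw, hfull u hu w hw]
  · simp [hu, hw, (hfull w hw u hu).symm]
  · simp [hu, hw, hout u hu w hw]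

/-- If deleting `v` leaves two cliques of size `n / 2` sharing one vertex, then all other vertices
of these cliques need `v` as a neighbour to reach degree `n / 2`, so `v` is universal. -/
theorem HalfRegularOff.twoCliques [DecidableEq V] {M A B : Finset V} {v : V}
    (h : HalfRegularOff G M) (hn : 5 ≤ Fintype.card V) (hA : A ⊆ univ.erase v)
    (hB : B ⊆ univ.erase v)
    (hcA : 2 * (#A + 1) = Fintype.card V) (hcB : 2 * (#B + 1) = Fintype.card V)
    (hd : Disjoint A B) (hadj : ∀ u ∈ univ.erase v, ∀ w ∈ univ.erase v, u ≠ w →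
      (G.Adj u w ↔ ¬ ((u ∈ A ∧ w ∈ B) ∨ (u ∈ B ∧ w ∈ A)))) :
    TwoCliques G A B := by
  obtain ⟨hMc, hM, hdeg⟩ := h
  have key : ∀ A B : Finset V, A ⊆ univ.erase v → B ⊆ univ.erase v → B.Nonempty →
      2 * (#B + 1) = Fintype.card V → (∀ a ∈ A, ∀ b ∈ B, a ≠ b ∧ ¬ G.Adj a b) →
      ∀ a ∈ A, G.Adj a v := by
    intro A B hA hB hBne hcB hno a ha
    by_contra hav
    have haM : a ∉ M := fun haM => by
      obtain ⟨b, hb⟩ := hBne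
      exact (hno a ha b hb).2 (hM a haM b (hno a ha b hb).1)
    have h1 := degIn_add_card_le (G := G) (u := a) (S := insert v B) fun w hw => by
      rcases mem_insert.1 hw with rfl | hw
      · exact ⟨(ne_of_mem_erase (hA ha)).symm, hav⟩
      · exact ⟨(hno a ha w hw).1.symm, (hno a ha w hw).2⟩
    rw [card_insert_of_notMem fun h => by simpa using hB h] at h1
    have := hdeg a haM
    omega
  have hno : ∀ a ∈ A, ∀ b ∈ B, a ≠ b ∧ ¬ G.Adj a b := fun a ha b hb => by
    have hab : a ≠ b := by rintro rfl; exact disjoint_left.1 hd ha hb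
    refine ⟨hab, ?_⟩
    rw [hadj a (hA ha) b (hB hb) hab]
    tauto
  have hAv := key A B hA hB (card_pos.1 (by omega)) hcB hno
  have hBv := key B A hB hA (card_pos.1 (by omega)) hcA fun b hb a ha =>
    ⟨(hno a ha b hb).1.symm, fun h => (hno a ha b hb).2 h.symm⟩
  have hvM : v ∈ M := by
    by_contra hvM
    have h1 := hdeg v hvM
    have h2 : #(A ∪ B) ≤ degIn G univ v := by
      classical
      refine card_le_card fun t ht => ?_
      simp only [mem_filter, mem_univ, true_and]
      rcases mem_union.1 ht with ht | ht
      · exact (hAv t ht).symm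
      · exact (hBv t ht).symm
    rw [card_union_of_disjoint hd] at h2
    omega
  have hvA : v ∉ A := fun h => by simpa using hA h
  have hvB : v ∉ B := fun h => by simpa using hB h
  refine ⟨hd, by omega, fun u w huw => ?_⟩
  by_cases hu : u = v
  · subst hu
    simp [hvA, hvB, hM u hvM w huw]
  by_cases hw : w = v
  · subst hw
    simp [hvA, hvB, (hM w hvM u huw.symm).symm]
  · exact hadj u (by simp [hu]) w (by simp [hw]) huw

theorem HalfRegularOff.hForceNumber_eq {M : Finset V} (h : HalfRegularOff G M)
    (hn : 5 ≤ Fintype.card V)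
    (hT : ∀ A B, 2 * (#A + 1) = Fintype.card V → #A = #B → ¬ TwoCliques G A B)
    (hB : ∀ I, ¬ BipHalf G I) : hForceNumber G = Fintype.card V := by
  classical
  have : Nonempty V := Fintype.card_pos_iff.1 (by omega)
  by_cases hz : ∃ z, z ∉ M
  swap
  · push Not at hz
    rw [show M = univ from eq_univ_of_forall hz] at h
    have := h.1
    rw [card_univ] at this
    omega
  obtain ⟨z, hz⟩ := hz
  obtain ⟨k, hk⟩ : ∃ k, Fintype.card V = 2 * k := ⟨_, (h.2.2 z hz).symm⟩
  have huniv := h.oreTight.hamOn_univ (by omega)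
  refine hForceNumber_eq_card huniv fun v => ?_
  have hcard : #(univ.erase v) + 1 = Fintype.card V := by
    rw [card_erase_add_one (mem_univ v), card_univ]
  have hdeg : ∀ u ∈ univ.erase v, k ≤ degIn G (univ.erase v) u + 1 := fun u _ => by
    have h1 := degIn_le_degIn_erase_add_one (G := G) univ u v
    have h2 : k ≤ degIn G univ u := by
      by_cases hu : u ∈ M
      · have := degIn_eq_of_nonadj_iff (G := G) (u := u) (S := ∅) fun w => by
          simpa using fun hw => h.2.1 u hu w (Ne.symm hw)
        simp at this
        omega
      · have := h.2.2 u hu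
        omega
    omega
  -- a Hamiltonian cycle of `G` starting at `v` yields a Hamiltonian path of `G - v`
  obtain ⟨f, hf, hmem⟩ := huniv
  obtain ⟨r, hr, hrv⟩ := exists_index hf.inj hmem (mem_univ v)
  obtain ⟨g, hg, hg0, -⟩ := hf.exists_rotate hr
  rw [hrv] at hg0
  rw [card_univ, ← hcard] at hg
  have hpath : IsPathSeq G (fun i => g (i + 1)) #(univ.erase v) :=
    ⟨fun i hi j hj e => by
      have := hg.inj _ (by omega) _ (by omega) e
      omega, fun i hi => hg.adj _ (by omega)⟩
  have hpm : ∀ i < #(univ.erase v), g (i + 1) ∈ univ.erase v := fun i hi => by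
    refine mem_erase.2 ⟨fun e => ?_, mem_univ _⟩
    have := hg.inj (i + 1) (by omega) 0 (by omega) (by rw [e, hg0])
    omega
  rcases hpath.hamOn_or hpm (k := k) (by omega) (by omega) hdeg with
    h1 | ⟨W, -, hWc, hW⟩ | ⟨A, hA, B, hB', hcA, hcB, hd, hadj⟩
  · exact h1
  · exact absurd (h.bipHalf hn (by omega) hW) (hB W)
  · exact absurd (h.twoCliques hn hA hB' (by omega) (by omega) hd hadj)
      (hT A B (by omega) (by omega))

end ForceNumbers

/-! ### The classes and their force numbers -/

section Classes

variable {V : Type*} [Fintype V] {G : SimpleGraph V}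

theorem mem_phi1_iff : G ∈ phi1 V ↔
    ∃ A B : Finset V, A.Nonempty ∧ 2 * #A < Fintype.card V ∧ TwoCliques G A B := by
  constructor
  · rintro ⟨m, h1, h2, h3⟩
    obtain ⟨A, B, hA, hB, hT⟩ := nonempty_iso_join_two_cliques_iff.1 h3
    have := hT.2.1
    exact ⟨A, B, card_pos.1 (by rw [hA]; omega), by rwa [hA], hT⟩
  · rintro ⟨A, B, hne, hle, hT⟩
    have := hT.2.1
    have := card_pos.2 hne
    exact ⟨#A, by omega, by omega,
      nonempty_iso_join_two_cliques_iff.2 ⟨A, B, rfl, by omega, hT⟩⟩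

theorem mem_phi2_iff : G ∈ phi2 V ↔ (∃ I, SplitHalf G I) ∨ ∃ I, BipHalf G I := by
  constructor
  · rintro ⟨k, hk, h⟩
    rwa [nonempty_iso_split_iff hk, nonempty_iso_bip_iff hk] at h
  · rintro (⟨I, hI⟩ | ⟨I, hI⟩)
    · exact ⟨#I, hI.1, Or.inl ((nonempty_iso_split_iff hI.1).2 ⟨I, hI⟩)⟩
    · exact ⟨#I, hI.1, Or.inr ((nonempty_iso_bip_iff hI.1).2 ⟨I, hI⟩)⟩

theorem mem_phi3_iff (hn : 5 ≤ Fintype.card V) : G ∈ phi3 V ↔ G = ⊤ ∨ ((∃ M, HalfRegularOff G M) ∧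
    (∀ A B, 2 * (#A + 1) = Fintype.card V → #A = #B → ¬ TwoCliques G A B) ∧
    ∀ I, ¬ BipHalf G I) := by
  have aux : ∀ k, Fintype.card V = 2 * k →
      (¬ Nonempty (G ≃g join (K 2) (K (k - 1) ⊕g K (k - 1))) ↔
        ∀ A B, 2 * (#A + 1) = Fintype.card V → #A = #B → ¬ TwoCliques G A B) := by
    intro k hk
    rw [nonempty_iso_join_two_cliques_iff]
    constructor
    · exact fun h A B h1 h2 hT => h ⟨A, B, by omega, by omega, hT⟩
    · rintro h ⟨A, B, h1, h2, hT⟩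
      exact h A B (by omega) (by omega) hT
  constructor
  · rintro (⟨k, hk, h1, h2, h3⟩ | h)
    · right
      refine ⟨(exists_iso_join_regular_iff hk).1 h1, (aux k hk).1 h2, ?_⟩
      rw [nonempty_iso_bip_iff hk] at h3
      exact not_exists.1 h3
    · exact Or.inl h
  · rintro (h | ⟨⟨M, hM⟩, h2, h3⟩)
    · exact Or.inr h
    · left
      obtain ⟨z, hz⟩ : ∃ z, z ∉ M := by
        by_contra! hz
        have := hM.1
        rw [show M = univ from eq_univ_of_forall hz, card_univ] at this
        omega
      have hk := (hM.2.2 z hz).symm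
      refine ⟨_, hk, (exists_iso_join_regular_iff hk).2 ⟨M, hM⟩, (aux _ hk).2 h2, ?_⟩
      rw [nonempty_iso_bip_iff hk]
      exact not_exists.2 h3

theorem hForceNumber_of_mem_phi1 (hn : 5 ≤ Fintype.card V) (h : G ∈ phi1 V) :
    hForceNumber G = Fintype.card V - 2 := by
  obtain ⟨A, B, hA, hle, hT⟩ := mem_phi1_iff.1 h
  have := hT.2.1
  exact hT.hForceNumber_eq hA (card_pos.1 (by omega)) hn

theorem two_mul_hForceNumber_of_mem_phi2 (hn : 5 ≤ Fintype.card V) (h : G ∈ phi2 V) :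
    2 * hForceNumber G = Fintype.card V := by
  rcases mem_phi2_iff.1 h with ⟨I, hI⟩ | ⟨I, hI⟩
  · rw [hI.hForceNumber_eq hn, hI.1]
  · rw [hI.hForceNumber_eq hn, hI.1]

theorem hForceNumber_of_mem_phi3 (hn : 5 ≤ Fintype.card V) (h : G ∈ phi3 V) :
    hForceNumber G = Fintype.card V := by
  rcases (mem_phi3_iff hn).1 h with rfl | ⟨⟨M, hM⟩, h1, h2⟩
  · exact hForceNumber_top hn
  · exact hM.hForceNumber_eq hn h1 h2

theorem weakClosures_eq (hn : 5 ≤ Fintype.card V) :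
    weakClosures V = phi1 V ∪ phi2 V ∪ phi3 V := by
  ext G
  rw [mem_weakClosures_iff, Set.mem_union, Set.mem_union, mem_phi1_iff, mem_phi2_iff,
    mem_phi3_iff hn]
  constructor
  · intro h
    rcases h.classification hn with h1 | h1 | h1 | ⟨M, hM⟩
    · exact Or.inl (Or.inl h1)
    · exact Or.inl (Or.inr (Or.inl h1))
    · exact Or.inr (Or.inl h1)
    · by_cases h2 : ∃ I, BipHalf G I
      · exact Or.inl (Or.inr (Or.inr h2))
      by_cases h3 : ∃ A B, 2 * (#A + 1) = Fintype.card V ∧ #A = #B ∧ TwoCliques G A B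
      · obtain ⟨A, B, hA, hAB, hT⟩ := h3
        exact Or.inl (Or.inl ⟨A, B, card_pos.1 (by omega), by omega, hT⟩)
      · exact Or.inr (Or.inr ⟨⟨M, hM⟩, fun A B h4 h5 h6 => h3 ⟨A, B, h4, h5, h6⟩,
          not_exists.1 h2⟩)
  · rintro ((⟨A, B, -, -, h⟩ | ⟨I, h⟩ | ⟨I, h⟩) | rfl | ⟨⟨M, h⟩, -⟩)
    · exact h.oreTight
    · exact h.oreTight
    · exact h.oreTight
    · exact fun u w huw hadj => absurd huw hadj
    · exact h.oreTight

end Classes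
end HForce

theorem theorem3p1 {V : Type*} [Fintype V] (hn : 5 ≤ Fintype.card V) :
    (HForce.weakClosures V = HForce.phi1 V ∪ HForce.phi2 V ∪ HForce.phi3 V ∧
      Disjoint (HForce.phi1 V) (HForce.phi2 V) ∧
      Disjoint (HForce.phi1 V) (HForce.phi3 V) ∧
      Disjoint (HForce.phi2 V) (HForce.phi3 V)) ∧
    ∀ Gw ∈ HForce.weakClosures V,
      (HForce.hForceNumber Gw = Fintype.card V - 2 ↔ Gw ∈ HForce.phi1 V) ∧
      ((HForce.hForceNumber Gw : ℚ) = (Fintype.card V : ℚ) / 2 ↔ Gw ∈ HForce.phi2 V) ∧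
      (HForce.hForceNumber Gw = Fintype.card V ↔ Gw ∈ HForce.phi3 V) := by
  have h1 := fun G => HForce.hForceNumber_of_mem_phi1 (G := G) hn
  have h2 := fun G => HForce.two_mul_hForceNumber_of_mem_phi2 (G := G) hn
  have h3 := fun G => HForce.hForceNumber_of_mem_phi3 (G := G) hn
  refine ⟨⟨HForce.weakClosures_eq hn, ?_, ?_, ?_⟩, fun G hG => ?_⟩
  · refine Set.disjoint_left.2 fun G a b => ?_
    have := h1 G a; have := h2 G b; omega
  · refine Set.disjoint_left.2 fun G a b => ?_
    have := h1 G a; have := h3 G b; omega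
  · refine Set.disjoint_left.2 fun G a b => ?_
    have := h2 G a; have := h3 G b; omega
  have hhalf : (HForce.hForceNumber G : ℚ) = (Fintype.card V : ℚ) / 2 ↔
      2 * HForce.hForceNumber G = Fintype.card V := by
    rw [eq_div_iff two_ne_zero, mul_comm]
    exact_mod_cast Iff.rfl
  have hmem : (G ∈ HForce.phi1 V ∨ G ∈ HForce.phi2 V) ∨ G ∈ HForce.phi3 V := by
    rwa [HForce.weakClosures_eq hn] at hG
  rw [hhalf]
  refine ⟨⟨fun h => ?_, h1 G⟩, ⟨fun h => ?_, h2 G⟩, ⟨fun h => ?_, h3 G⟩⟩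
  · rcases hmem with (h' | h') | h'
    · exact h'
    · have := h2 G h'; omega
    · have := h3 G h'; omega
  · rcases hmem with (h' | h') | h'
    · have := h1 G h'; omega
    · exact h'
    · have := h3 G h'; omega
  · rcases hmem with (h' | h') | h'
    · have := h1 G h'; omega
    · have := h2 G h'; omega
    · exact h'
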